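/- Let $C$ be a Riemann surface (connected, Hausdorff) with a spin structure $\Omega_C^{1/2}$, i.e. a cover of $C$ by holomorphic coordinates $z_U$ together with holomorphic functions $\zeta_{UV}$ on $U\cap V$ satisfying $\zeta_{UV}^2=dz_V/dz_U$ and $\zeta_{UW}=\zeta_{UV}\zeta_{VW}$. Let $\mathcal S=\Pi\Omega_C^{1/2}$ be the corresponding super Riemann surface, with transition maps $(x,\theta)\mapsto(f_{UV}(x),\zeta_{UV}(x)\theta)$, where $x=z_U$ and $f_{UV}=z_V\circ z_U^{-1}$. Write $H^1$ for Čech cohomology (the limit over open covers), $\mathcal T_C$ for the sheaf of holomorphic vector fields and $\mathcal T_C^{1/2}$ for the sheaf of sections of the dual of $\Omega_C^{1/2}$. An odd second-order deformation of $\mathcal S$ is a complex supermanifold $\mathcal X$ of dimension $(1|3)$ with reduced space $C$ and an atlas, over some refinement of the above cover (with the restricted coordinates), of charts with coordinates $(x,\theta,\xi_1,\xi_2)$, whose transition maps fix $\xi_1,\xi_2$ and have the form $$y=f_{UV}+\sum_{a} f^a_{UV}\,\xi_a\theta+g^{12}_{UV}\,\xi_1\xi_2,\qquad \eta=\zeta_{UV}\,\theta+\sum_a\psi^a_{UV}\,\xi_a+\zeta^{12}_{UV}\,\xi_1\xi_2\theta$$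 with coefficients holomorphic in $x$, and are superconformal, that is, $f_{UV}'=\zeta_{UV}^2$, $f^a_{UV}=\zeta_{UV}\psi^a_{UV}$ and $(g^{12}_{UV})'=2\zeta_{UV}\zeta^{12}_{UV}-\big((\psi^1_{UV})'\psi^2_{UV}-\psi^1_{UV}(\psi^2_{UV})'\big)$. Its Kodaira–Spencer map vanishes if for $a=1,2$ the class of the cocycle $\{\psi^a_{UV}\,\partial/\partial\eta\}$ in $H^1(C,\mathcal T_C^{1/2})$ is zero. Its modelling bundle $E$ has the frames $(\theta,\xi_1,\xi_2)$, with the linear parts of the changes of the odd coordinates as transition functions; its primary obstruction class is the class of the cocycle $\{(\sum_a f^a_{UV}\xi_a\theta+g^{12}_{UV}\xi_1\xi_2)\,\partial/\partial y\}$ in $H^1(C,\wedge^2\mathcal E\otimes\mathcal T_C)$. The supermanifold $\mathcal X$ is split if it is isomorphic, as a space with a sheaf of $\mathbb Z/2$-graded $\mathbb C$-algebras, to $(C,\wedge^\bullet\mathcal F)$ for some holomorphic vector bundle $F$ on $C$ (equivalently, for its modelling bundle). Then: 1. If $H^1(C,\mathcal T_C)\neq0$, there exists an odd second-order deformation of $\mathcal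 S$ whose Kodaira–Spencer map vanishes and which is non-split. 2. More precisely, for every non-zero class $\gamma\in H^1(C,\mathcal T_C)$ there exist an odd second-order deformation $\mathcal X$ of $\mathcal S$ and a $\mathcal T_C$-valued cocycle $\{g^{12}_{UV}\,\partial/\partial y\}$ representing $\gamma$ on the cover of its superconformal atlas, such that the transition maps of this atlas are $$y=f_{UV}+g^{12}_{UV}\,\xi_1\xi_2,\qquad \eta=\zeta_{UV}\,\theta+\tfrac12\,\zeta_{UV}^{-1}\,\frac{\partial g^{12}_{UV}}{\partial x}\,\xi_1\xi_2\theta ;$$ the Kodaira–Spencer map of $\mathcal X$ vanishes; the primary obstruction class of $\mathcal X$ is represented by the cocycle $\{g^{12}_{UV}\,\xi_1\xi_2\,\partial/\partial y\}$ and is non-zero; and $\mathcal X$ is non-split. -/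

import Mathlib

open CategoryTheory Opposite TopologicalSpace Manifold
open scoped ContDiff

universe u

noncomputable section

/-! ## First Čech cohomology of a presheaf of abelian groups

`CechH1 F` is the direct limit over all open covers of the first Čech cohomology groups of the
covers (as a pointed set, which is all that is needed). -/

namespace Cech

variable {C : Type u} [TopologicalSpace C]

/-- Restriction of sections from `W` to a smaller open set `W'`. -/
def res (F : (Opens C)ᵒᵖ ⥤ AddCommGrpCat.{u}) {W W' : Opens C} (h : W' ≤ W) :
    F.obj (op W) →+ F.obj (op W') :=
  (F.map (homOfLE h).op).hom

theorem res_res (F : (Opens C)ᵒᵖ ⥤ AddCommGrpCat.{u}) {W W' W'' : Opens C}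
    (h : W' ≤ W) (h' : W'' ≤ W') (s : F.obj (op W)) :
    res F h' (res F h s) = res F (h'.trans h) s := by
  have : F.map (homOfLE (h'.trans h)).op = F.map (homOfLE h).op ≫ F.map (homOfLE h').op := by
    rw [← F.map_comp]
    rfl
  simp [res, this]

/-- 1-cocycles `c = (c i j)` on the family `U`: `c i k = c i j + c j k` on triple intersections. -/
structure Cocycle (F : (Opens C)ᵒᵖ ⥤ AddCommGrpCat.{u}) {ι : Type u} (U : ι → Opens C) where
  val : ∀ i j : ι, F.obj (op (U i ⊓ U j))
  cocycle : ∀ i j k : ι,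
    res F (W' := U i ⊓ U j ⊓ U k) (le_inf (inf_le_left.trans inf_le_left) inf_le_right) (val i k) =
      res F inf_le_left (val i j) +
        res F (le_inf (inf_le_left.trans inf_le_right) inf_le_right) (val j k)

/-- An open cover of `C` together with a 1-cocycle on it. -/
structure CoverCocycle (F : (Opens C)ᵒᵖ ⥤ AddCommGrpCat.{u}) where
  ι : Type u
  U : ι → Opens C
  cover : ∀ p : C, ∃ i, p ∈ U i
  c : Cocycle F U

/-- Two cocycles (on possibly different covers) are cohomologous if on some common refinement of
the two covers they differ by a coboundary. -/
def Cohomologous {F : (Opens C)ᵒᵖ ⥤ AddCommGrpCat.{u}} (a b : CoverCocycle F) : Prop :=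
  ∃ (κ : Type u) (V : κ → Opens C) (σ : κ → a.ι) (τ : κ → b.ι)
    (hσ : ∀ k, V k ≤ a.U (σ k)) (hτ : ∀ k, V k ≤ b.U (τ k)) (β : ∀ k, F.obj (op (V k))),
    (∀ p : C, ∃ k, p ∈ V k) ∧
    ∀ k l,
      res F (inf_le_inf (hσ k) (hσ l)) (a.c.val (σ k) (σ l)) -
          res F (inf_le_inf (hτ k) (hτ l)) (b.c.val (τ k) (τ l)) =
        res F inf_le_right (β l) - res F inf_le_left (β k)

/-- The cocycle relation restricted to an open set contained in the triple intersection. -/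
theorem Cocycle.res_eq {F : (Opens C)ᵒᵖ ⥤ AddCommGrpCat.{u}} {ι : Type u} {U : ι → Opens C}
    (c : Cocycle F U) {W : Opens C} {i j k : ι} (hi : W ≤ U i) (hj : W ≤ U j) (hk : W ≤ U k) :
    res F (le_inf hi hk) (c.val i k) =
      res F (le_inf hi hj) (c.val i j) + res F (le_inf hj hk) (c.val j k) := by
  have := congrArg (res F (le_inf (le_inf hi hj) hk)) (c.cocycle i j k)
  rw [map_add, res_res, res_res, res_res] at this
  exact this

theorem Cohomologous.refl {F : (Opens C)ᵒᵖ ⥤ AddCommGrpCat.{u}} (a : CoverCocycle F) :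
    Cohomologous a a :=
  ⟨a.ι, a.U, id, id, fun _ => le_rfl, fun _ => le_rfl, fun _ => 0, a.cover, by simp⟩

theorem Cohomologous.symm {F : (Opens C)ᵒᵖ ⥤ AddCommGrpCat.{u}} {a b : CoverCocycle F}
    (h : Cohomologous a b) : Cohomologous b a := by
  obtain ⟨κ, V, σ, τ, hσ, hτ, β, hV, h⟩ := h
  refine ⟨κ, V, τ, σ, hτ, hσ, fun k => - β k, hV, fun k l => ?_⟩
  rw [← neg_sub, h k l, map_neg, map_neg]
  abel

theorem Cohomologous.trans {F : (Opens C)ᵒᵖ ⥤ AddCommGrpCat.{u}} {a b c : CoverCocycle F}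
    (h₁ : Cohomologous a b) (h₂ : Cohomologous b c) : Cohomologous a c := by
  obtain ⟨κ, V, σ, τ, hσ, hτ, β, hV, h⟩ := h₁
  obtain ⟨κ', V', σ', τ', hσ', hτ', β', hV', h'⟩ := h₂
  refine ⟨κ × κ', fun x => V x.1 ⊓ V' x.2, fun x => σ x.1, fun x => τ' x.2,
    fun x => inf_le_left.trans (hσ _), fun x => inf_le_right.trans (hτ' _),
    fun x => res F inf_le_left (β x.1) + res F inf_le_right (β' x.2) -
      res F (le_inf (inf_le_left.trans (hτ _)) (inf_le_right.trans (hσ' _)))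
        (b.c.val (τ x.1) (σ' x.2)), ?_, ?_⟩
  · intro p
    obtain ⟨k, hk⟩ := hV p
    obtain ⟨k', hk'⟩ := hV' p
    exact ⟨(k, k'), hk, hk'⟩
  · rintro ⟨k, k'⟩ ⟨l, l'⟩
    have hW : V k ⊓ V' k' ⊓ (V l ⊓ V' l') ≤ V k ⊓ V l := inf_le_inf inf_le_left inf_le_left
    have hW' : V k ⊓ V' k' ⊓ (V l ⊓ V' l') ≤ V' k' ⊓ V' l' := inf_le_inf inf_le_right inf_le_right
    have e := congrArg (res F hW) (h k l)
    have e' := congrArg (res F hW') (h' k' l')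
    simp only [map_sub, map_add, res_res] at e e' ⊢
    have h1 := hW.trans (inf_le_left.trans (hτ k))
    have h2 := hW.trans (inf_le_right.trans (hτ l))
    have h3 := hW'.trans (inf_le_left.trans (hσ' k'))
    have h4 := hW'.trans (inf_le_right.trans (hσ' l'))
    have t1 := b.c.res_eq h1 h3 h4
    have t2 := b.c.res_eq h1 h2 h4
    have e3 := (congrArg₂ (· + ·) e e')
    have t3 := t2.symm.trans t1
    rw [← sub_eq_zero] at e3 t3 ⊢
    rw [← e3, ← sub_eq_zero]
    rw [← t3]
    abel

/-- Being cohomologous is an equivalence relation on cocycles. -/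
def setoid (F : (Opens C)ᵒᵖ ⥤ AddCommGrpCat.{u}) : Setoid (CoverCocycle F) :=
  ⟨Cohomologous, Cohomologous.refl, Cohomologous.symm, Cohomologous.trans⟩

/-- The zero cocycle on a cover. -/
def Cocycle.zero (F : (Opens C)ᵒᵖ ⥤ AddCommGrpCat.{u}) {ι : Type u} (U : ι → Opens C) :
    Cocycle F U where
  val _ _ := 0
  cocycle := by simp

end Cech

/-- The first Čech cohomology `H¹(C, F)`: cocycles on open covers, up to equality in the
direct limit over refinements. -/
def CechH1 {C : Type u} [TopologicalSpace C] (F : (Opens C)ᵒᵖ ⥤ AddCommGrpCat.{u}) : Type (u + 1) :=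
  Quotient (Cech.setoid F)

namespace CechH1

variable {C : Type u} [TopologicalSpace C] {F : (Opens C)ᵒᵖ ⥤ AddCommGrpCat.{u}}

/-- The class of a cocycle on an open cover. -/
def mk {ι : Type u} {U : ι → Opens C} (hU : ∀ p : C, ∃ i, p ∈ U i) (c : Cech.Cocycle F U) :
    CechH1 F :=
  Quotient.mk (Cech.setoid F) ⟨ι, U, hU, c⟩

instance : Zero (CechH1 F) :=
  ⟨mk (ι := PUnit) (U := fun _ => ⊤) (fun _ => ⟨PUnit.unit, trivial⟩) (Cech.Cocycle.zero F _)⟩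

end CechH1

/-! ## Holomorphic functions with values in finite-dimensional spaces; the sheaves involved -/

theorem mem_inf {C : Type u} [TopologicalSpace C] {W V : Opens C} {p : C} (hW : p ∈ W)
    (hV : p ∈ V) : p ∈ W ⊓ V := ⟨hW, hV⟩

section Surface

variable {C : Type u} [TopologicalSpace C] [ChartedSpace ℂ C]

/-- A function from an open subset of `C` to a (finite-dimensional) complex vector space is
holomorphic if its composition with every linear functional is. -/
def IsHol {W : Opens C} {F : Type*} [AddCommGroup F] [Module ℂ F] (s : W → F) : Prop :=
  ∀ ℓ : Module.Dual ℂ F, MDifferentiable 𝓘(ℂ, ℂ) 𝓘(ℂ, ℂ) (fun p : W => ℓ (s p))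

theorem mdifferentiable_inclusion {W W' : Opens C} (h : W' ≤ W) :
    MDifferentiable 𝓘(ℂ, ℂ) 𝓘(ℂ, ℂ) (Opens.inclusion h) :=
  (contMDiff_inclusion (n := 1) h).mdifferentiable one_ne_zero

namespace IsHol

variable {W : Opens C} {F : Type*} [AddCommGroup F] [Module ℂ F]

theorem restrict {W' : Opens C} (h : W' ≤ W) {s : W → F} (hs : IsHol s) :
    IsHol (fun p : W' => s (Opens.inclusion h p)) :=
  fun ℓ => (hs ℓ).comp (mdifferentiable_inclusion h)

theorem zero : IsHol (fun _ : W => (0 : F)) := fun ℓ => by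
  simpa using mdifferentiable_const

theorem const (v : F) : IsHol (fun _ : W => v) := fun _ => mdifferentiable_const

theorem add {s t : W → F} (hs : IsHol s) (ht : IsHol t) : IsHol (fun p => s p + t p) := fun ℓ => by
  simp only [map_add]
  exact (hs ℓ).add (ht ℓ)

theorem neg {s : W → F} (hs : IsHol s) : IsHol (fun p => - s p) := fun ℓ => by
  simp only [map_neg]
  exact (hs ℓ).neg

theorem map {G : Type*} [AddCommGroup G] [Module ℂ G] {s : W → F} (hs : IsHol s) (L : F →ₗ[ℂ] G) :
    IsHol (fun p => L (s p)) :=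
  fun ℓ => hs (ℓ.comp L)

theorem mul {A : Type*} [Ring A] [Algebra ℂ A] [Module.Finite ℂ A] {s t : W → A}
    (hs : IsHol s) (ht : IsHol t) : IsHol (fun p => s p * t p) := fun ℓ => by
  let b := Module.finBasis ℂ A
  have key : (fun p => ℓ (s p * t p)) =
      fun p => ∑ i, ∑ j, b.coord i (s p) * (b.coord j (t p) * ℓ (b i * b j)) := by
    funext p
    conv_lhs => rw [← b.sum_repr (s p), ← b.sum_repr (t p)]
    simp only [Finset.sum_mul_sum, map_sum, smul_mul_assoc, mul_smul_comm, map_smul, smul_eq_mul,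
      Module.Basis.coord_apply]
    exact Finset.sum_congr rfl fun i _ => Finset.sum_congr rfl fun j _ => by ring
  rw [key]
  have h : ∀ i j, MDifferentiable 𝓘(ℂ, ℂ) 𝓘(ℂ, ℂ)
      (fun p => b.coord i (s p) * (b.coord j (t p) * ℓ (b i * b j))) := fun i j =>
    (hs (b.coord i)).mul ((ht (b.coord j)).mul mdifferentiable_const)
  intro p
  have := MDifferentiableAt.sum (t := Finset.univ) fun i _ =>
    MDifferentiableAt.sum (t := Finset.univ) fun j _ => h i j p
  convert this using 1
  funext q
  simp [Finset.sum_apply]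

end IsHol

/-! ### Holomorphic vector fields -/

/-- The component of a tangent vector in the coordinate `e`: the coefficient of `∂/∂e`. -/
def chartComponent (e : OpenPartialHomeomorph C ℂ) (p : C) (v : TangentSpace 𝓘(ℂ, ℂ) p) : ℂ :=
  mfderiv 𝓘(ℂ, ℂ) 𝓘(ℂ, ℂ) e p v

variable (C) in
/-- Holomorphic vector fields on `W`: fields of tangent vectors whose component in every
holomorphic coordinate is a holomorphic function. -/
def vectorFields (W : Opens C) : AddSubgroup (∀ p : W, TangentSpace 𝓘(ℂ, ℂ) (p : C)) where
  carrier := {v | ∀ e ∈ IsManifold.maximalAtlas 𝓘(ℂ, ℂ) ω C,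
    IsHol (W := W ⊓ ⟨e.source, e.open_source⟩)
      (fun p => chartComponent e (p : C) (v ⟨(p : C), p.2.1⟩))}
  zero_mem' e _ := by
    simpa [chartComponent] using! IsHol.zero
  add_mem' hv hw e he := by
    simpa [chartComponent] using! (hv e he).add (hw e he)
  neg_mem' hv e he := by
    simpa [chartComponent] using! (hv e he).neg

variable (C) in
/-- The sheaf `T_C` of holomorphic vector fields. -/
def tangentSheaf : (Opens C)ᵒᵖ ⥤ AddCommGrpCat.{u} where
  obj W := AddCommGrpCat.of (vectorFields C W.unop)
  map {W W'} i := AddCommGrpCat.ofHom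
    { toFun := fun v => ⟨fun p => v.1 (Opens.inclusion i.unop.le p), fun e he =>
        (v.2 e he).restrict (inf_le_inf_right _ i.unop.le)⟩
      map_zero' := rfl
      map_add' := fun _ _ => rfl }

/-! ### Sheaves of sections of holomorphic vector bundles given by transition functions -/

/-- Sections over `W` of the bundle with fibre `F` glued from trivial bundles on the `V k` by
`A k l p`, the change from the frame over `V l` to the frame over `V k`: families of holomorphic
local components `s k` on `W ∩ V k` with `s k = A k l (s l)`. -/
def bundleSections {κ : Type u} (V : κ → Opens C) {F : Type} [AddCommGroup F] [Module ℂ F]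
    (A : κ → κ → C → F →ₗ[ℂ] F) (W : Opens C) :
    AddSubgroup (∀ k, (W ⊓ V k : Opens C) → F) where
  carrier := {s | (∀ k, IsHol (s k)) ∧
    ∀ k l p (hW : p ∈ W) (hk : p ∈ V k) (hl : p ∈ V l),
      s k ⟨p, mem_inf hW hk⟩ = A k l p (s l ⟨p, mem_inf hW hl⟩)}
  zero_mem' := ⟨fun _ => IsHol.zero, by simp⟩
  add_mem' hs ht := ⟨fun k => (hs.1 k).add (ht.1 k), fun k l p hW hk hl => by
    simp [hs.2 k l p hW hk hl, ht.2 k l p hW hk hl]⟩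
  neg_mem' hs := ⟨fun k => (hs.1 k).neg, fun k l p hW hk hl => by
    simp [hs.2 k l p hW hk hl]⟩

/-- The sheaf of holomorphic sections of the bundle with transition functions `A`. -/
def bundleSheaf {κ : Type u} (V : κ → Opens C) {F : Type} [AddCommGroup F] [Module ℂ F]
    (A : κ → κ → C → F →ₗ[ℂ] F) : (Opens C)ᵒᵖ ⥤ AddCommGrpCat.{u} where
  obj W := AddCommGrpCat.of (bundleSections V A W.unop)
  map {W W'} i := AddCommGrpCat.ofHom
    { toFun := fun s => ⟨fun k p => s.1 k (Opens.inclusion (inf_le_inf_right _ i.unop.le) p),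
        fun k => (s.2.1 k).restrict (inf_le_inf_right _ i.unop.le),
        fun k l p hW hk hl => s.2.2 k l p (i.unop.le hW) hk hl⟩
      map_zero' := rfl
      map_add' := fun _ _ => rfl }

/-- A holomorphic function defined on (at least) an open set, as total function on `C`. -/
def HolOn (h : C → ℂ) (W : Opens C) : Prop :=
  MDifferentiableOn 𝓘(ℂ, ℂ) 𝓘(ℂ, ℂ) h W

/-- The derivative of `h` with respect to the coordinate `e`. -/
def coordDeriv (e : OpenPartialHomeomorph C ℂ) (h : C → ℂ) (p : C) : ℂ :=
  deriv (h ∘ e.symm) (e p)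

/-! ## Complex supermanifolds with reduced space `C` -/

/-- The Grassmann algebra on `q` odd generators. -/
abbrev Grassmann (q : ℕ) : Type := ExteriorAlgebra ℂ (Fin q → ℂ)

namespace Grassmann

instance (q : ℕ) : Module.Finite ℂ (Grassmann q) :=
  Module.Finite.of_basis (Pi.basisFun ℂ (Fin q)).ExteriorAlgebra

/-- The odd generators. -/
def gen {q : ℕ} (a : Fin q) : Grassmann q := ExteriorAlgebra.ι ℂ (Pi.single a 1)

/-- The parity automorphism: `+1` on even and `-1` on odd elements. -/
def parity (q : ℕ) : Grassmann q →ₐ[ℂ] Grassmann q := ExteriorAlgebra.map (-LinearMap.id)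

theorem parity_parity {q : ℕ} (x : Grassmann q) : parity q (parity q x) = x := by
  simp only [parity, ← AlgHom.comp_apply, ExteriorAlgebra.map_comp_map]
  have : (-LinearMap.id : (Fin q → ℂ) →ₗ[ℂ] (Fin q → ℂ)) ∘ₗ (-LinearMap.id) = LinearMap.id := by
    ext
    simp
  rw [this, ExteriorAlgebra.map_id, AlgHom.id_apply]

end Grassmann

variable (C) in
/-- A topological space `C` with a presheaf of `ℤ/2`-graded complex algebras. The grading is
recorded by the parity involution `par`, which is `+1` on even and `-1` on odd sections. -/
structure SuperRingedSpace where
  O : TopCat.Presheaf (AlgCat.{u} ℂ) (TopCat.of C)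
  par : O ⟶ O
  par_par : par ≫ par = 𝟙 O

namespace SuperRingedSpace

/-- Sections of the structure sheaf over `W`. -/
abbrev Sec (X : SuperRingedSpace C) (W : Opens C) : Type u := X.O.obj (op W)

/-- Restriction of sections. -/
def res (X : SuperRingedSpace C) {W W' : Opens C} (h : W' ≤ W) : X.Sec W →ₐ[ℂ] X.Sec W' :=
  (X.O.map (homOfLE h).op).hom

/-- The parity involution on the sections over `W`. -/
def parity (X : SuperRingedSpace C) (W : Opens C) : X.Sec W →ₐ[ℂ] X.Sec W :=
  (X.par.app (op W)).hom

/-- An isomorphism of spaces with sheaves of `ℤ/2`-graded complex algebras: a homeomorphism together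
with an isomorphism of the sheaves of graded algebras over it. -/
structure Iso (X Y : SuperRingedSpace C) where
  homeo : C ≃ₜ C
  equiv : ∀ W : Opens C, X.Sec (Opens.comap (homeo : C(C, C)) W) ≃ₐ[ℂ] Y.Sec W
  map_res : ∀ {W W' : Opens C} (h : W' ≤ W) (s : X.Sec (Opens.comap (homeo : C(C, C)) W)),
    equiv W' (X.res (Opens.comap_mono _ h) s) = Y.res h (equiv W s)
  map_parity : ∀ (W : Opens C) (s : X.Sec (Opens.comap (homeo : C(C, C)) W)),
    equiv W (X.parity _ s) = Y.parity W (equiv W s)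

end SuperRingedSpace

/-- The algebra `O_C(W) ⊗ Λ[θ₁, …, θ_q]` of superfunctions on `W`: holomorphic functions with values
in the Grassmann algebra. -/
def superFun (q : ℕ) (W : Opens C) : Subalgebra ℂ (W → Grassmann q) where
  carrier := {s | IsHol s}
  mul_mem' hs ht := hs.mul ht
  add_mem' hs ht := hs.add ht
  algebraMap_mem' _ := IsHol.const _

/-- A chart of dimension `(1|q)` on the open set `U`: an isomorphism, over `U`, of the structure
sheaf of `X` with the sheaf of superfunctions. -/
structure SuperChart (X : SuperRingedSpace C) (q : ℕ) (U : Opens C) where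
  equiv : ∀ W : Opens C, W ≤ U → (X.Sec W ≃ₐ[ℂ] superFun q W)
  map_res : ∀ {W W' : Opens C} (h : W' ≤ W) (hW : W ≤ U) (s : X.Sec W) (p : W'),
    (equiv W' (h.trans hW) (X.res h s)).1 p = (equiv W hW s).1 (Opens.inclusion h p)
  map_parity : ∀ (W : Opens C) (hW : W ≤ U) (s : X.Sec W) (p : W),
    (equiv W hW (X.parity W s)).1 p = Grassmann.parity q ((equiv W hW s).1 p)

variable (C) in
/-- A `(1|q)`-dimensional complex supermanifold with reduced space `C`: a sheaf of `ℤ/2`-graded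
algebras on `C` which is locally isomorphic to the sheaf of superfunctions, that is, to the
exterior algebra of a holomorphic bundle of rank `q`. -/
structure Supermanifold (q : ℕ) extends SuperRingedSpace C where
  isSheaf : O.IsSheaf
  locally_split : ∀ p : C, ∃ U : Opens C, p ∈ U ∧ Nonempty (SuperChart toSuperRingedSpace q U)

variable (C) in
/-- A holomorphic vector bundle `E` of rank `q` on `C` given by transition functions:
`B k l p` is the change from the frame over `V l` to the frame over `V k`. -/
structure HolBundle (q : ℕ) where
  κ : Type u
  V : κ → Opens C
  cover : ∀ p : C, ∃ k, p ∈ V k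
  B : κ → κ → C → (Fin q → ℂ) →ₗ[ℂ] (Fin q → ℂ)
  hol : ∀ k l v a, HolOn (fun p => B k l p v a) (V k ⊓ V l)
  self : ∀ k, ∀ p ∈ V k, B k k p = LinearMap.id
  cocycle : ∀ k l m p, p ∈ V k → p ∈ V l → p ∈ V m → B k l p ∘ₗ B l m p = B k m p

namespace HolBundle

variable {q : ℕ} (E : HolBundle C q)

/-- Sections over `W` of the exterior algebra `⋀ E`: families of Grassmann-algebra valued local
components, transforming by the algebra maps that the transition functions of `E` induce. -/
def exteriorSections (W : Opens C) : Subalgebra ℂ (∀ k, (W ⊓ E.V k : Opens C) → Grassmann q) where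
  carrier := {s | (∀ k, IsHol (s k)) ∧
    ∀ k l p (hW : p ∈ W) (hk : p ∈ E.V k) (hl : p ∈ E.V l),
      s k ⟨p, mem_inf hW hk⟩ = ExteriorAlgebra.map (E.B k l p) (s l ⟨p, mem_inf hW hl⟩)}
  mul_mem' hs ht := ⟨fun k => (hs.1 k).mul (ht.1 k), fun k l p hW hk hl => by
    simp [hs.2 k l p hW hk hl, ht.2 k l p hW hk hl]⟩
  add_mem' hs ht := ⟨fun k => (hs.1 k).add (ht.1 k), fun k l p hW hk hl => by
    simp [hs.2 k l p hW hk hl, ht.2 k l p hW hk hl]⟩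
  algebraMap_mem' _ := ⟨fun _ => IsHol.const _, by simp⟩

theorem parity_mem {W : Opens C} {s : ∀ k, (W ⊓ E.V k : Opens C) → Grassmann q}
    (hs : s ∈ E.exteriorSections W) :
    (fun k p => Grassmann.parity q (s k p)) ∈ E.exteriorSections W := by
  refine ⟨fun k => (hs.1 k).map (Grassmann.parity q).toLinearMap, fun k l p hW hk hl => ?_⟩
  change Grassmann.parity q (s k ⟨p, mem_inf hW hk⟩) =
    ExteriorAlgebra.map (E.B k l p) (Grassmann.parity q (s l ⟨p, mem_inf hW hl⟩))
  rw [hs.2 k l p hW hk hl]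
  simp only [Grassmann.parity, ← AlgHom.comp_apply, ExteriorAlgebra.map_comp_map]
  congr 2
  ext
  simp

/-- The split model `ΠE = (C, ⋀ E)`. -/
def splitModel : SuperRingedSpace C where
  O :=
    { obj := fun W => AlgCat.of ℂ (E.exteriorSections W.unop)
      map := fun {W W'} i => AlgCat.ofHom
        { toFun := fun s => ⟨fun k p => s.1 k (Opens.inclusion (inf_le_inf_right _ i.unop.le) p),
            fun k => (s.2.1 k).restrict (inf_le_inf_right _ i.unop.le),
            fun k l p hW hk hl => s.2.2 k l p (i.unop.le hW) hk hl⟩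
          map_one' := rfl
          map_mul' := fun _ _ => rfl
          map_zero' := rfl
          map_add' := fun _ _ => rfl
          commutes' := fun _ => rfl } }
  par :=
    { app := fun W => AlgCat.ofHom
        { toFun := fun s => ⟨fun k p => Grassmann.parity q (s.1 k p), E.parity_mem s.2⟩
          map_one' := by ext; simp
          map_mul' := fun _ _ => by ext; simp
          map_zero' := by ext; simp
          map_add' := fun _ _ => by ext; simp
          commutes' := fun _ => by ext; simp } }
  par_par := by
    ext W s k p
    change Grassmann.parity q (Grassmann.parity q (s.1 k p)) = s.1 k p
    exact Grassmann.parity_parity _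

end HolBundle

/-- A supermanifold is split if it is isomorphic to the split model of some holomorphic vector
bundle (which is then necessarily isomorphic to its modelling bundle). -/
def Supermanifold.IsSplit {q : ℕ} (X : Supermanifold C q) : Prop :=
  ∃ E : HolBundle C q, Nonempty (X.toSuperRingedSpace.Iso E.splitModel)

/-! ## Spin structures and second-order odd deformations -/

variable (C) in
/-- A spin structure `Ω_C^{1/2}` on `C`, given by transition functions: a cover by holomorphic
coordinates `z i`, and square roots `ζ i j` of `dz_j/dz_i` satisfying the cocycle condition.
The super Riemann surface `S = ΠΩ_C^{1/2}` has the transition maps `(z_j, ζ i j θ)`. -/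
structure SpinStructure where
  ι : Type u
  z : ι → OpenPartialHomeomorph C ℂ
  z_mem : ∀ i, z i ∈ IsManifold.maximalAtlas 𝓘(ℂ, ℂ) ω C
  cover : ∀ p : C, ∃ i, p ∈ (z i).source
  ζ : ι → ι → C → ℂ
  hol : ∀ i j, HolOn (ζ i j) (⟨(z i).source, (z i).open_source⟩ ⊓ ⟨(z j).source, (z j).open_source⟩)
  sq : ∀ i j, ∀ p ∈ (z i).source, p ∈ (z j).source → ζ i j p ^ 2 = coordDeriv (z i) (z j) p
  cocycle : ∀ i j k, ∀ p ∈ (z i).source, p ∈ (z j).source → p ∈ (z k).source →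
    ζ i k p = ζ i j p * ζ j k p

namespace SpinStructure

variable (S : SpinStructure C)

/-- The domain of the coordinate `z i`. -/
def dom (i : S.ι) : Opens C := ⟨(S.z i).source, (S.z i).open_source⟩

/-- The sheaf `T_C^{1/2}`, the dual of `Ω_C^{1/2}`: sections `s i ∂/∂θ_i = s j ∂/∂θ_j`, with
`θ_j = ζ i j θ_i`. -/
def halfTangentSheaf : (Opens C)ᵒᵖ ⥤ AddCommGrpCat.{u} :=
  bundleSheaf S.dom (F := ℂ) (fun i j p => S.ζ j i p • LinearMap.id)

theorem holOn_z [IsManifold 𝓘(ℂ, ℂ) ω C] (i : S.ι) : HolOn (S.z i) (S.dom i) :=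
  (contMDiffOn_of_mem_maximalAtlas (S.z_mem i)).mdifferentiableOn (by simp)

end SpinStructure

/-- The restriction of a holomorphic function of `C` as a superfunction. -/
def superFun.ofHol {q : ℕ} {W : Opens C} (h : C → ℂ) (hh : HolOn h W) : superFun q W :=
  ⟨fun p => algebraMap ℂ (Grassmann q) (h p), by
    have h1 : IsHol (fun p : W => h p) := fun ℓ => by
      have h2 : MDifferentiable 𝓘(ℂ, ℂ) 𝓘(ℂ, ℂ) (fun p : W => h p) := fun p =>
        ((hh p p.2).mdifferentiableAt (W.isOpen.mem_nhds p.2)).comp p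
          ((contMDiff_subtype_val (n := 1)).mdifferentiable one_ne_zero p)
      have h3 : (fun p : W => ℓ (h p)) = fun p : W => h p * ℓ 1 := by
        funext p
        rw [← smul_eq_mul, ← map_smul, smul_eq_mul, mul_one]
      rw [h3]
      exact h2.mul mdifferentiable_const
    exact h1.map (Algebra.linearMap ℂ (Grassmann q))⟩

/-- The odd coordinate functions. -/
def superFun.gen {q : ℕ} {W : Opens C} (a : Fin q) : superFun q W :=
  ⟨fun _ => Grassmann.gen a, IsHol.const _⟩

/-- The change of coordinates between two charts on an open set `W` contained in both of their
domains: it rewrites a superfunction of the coordinates of `Ψ` in the coordinates of `Φ`. -/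
def SuperChart.transition {X : SuperRingedSpace C} {q : ℕ} {U V : Opens C}
    (Φ : SuperChart X q U) (Ψ : SuperChart X q V) (W : Opens C) (hU : W ≤ U) (hV : W ≤ V) :
    superFun q W ≃ₐ[ℂ] superFun q W :=
  (Ψ.equiv W hV).symm.trans (Φ.equiv W hU)

/-- A superconformal atlas of order two with respect to the super Riemann surface `S = ΠΩ_C^{1/2}`
on a `(1|3)`-dimensional supermanifold `X`. In each chart there are the even coordinate `x` (the
coordinate of `S`) and the odd coordinates `θ` (number `0`) and `ξ₁, ξ₂` (numbers `1, 2`).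
On overlaps the coordinates `(y, η, ξ)` of the chart `l` and `(x, θ, ξ)` of the chart `k` satisfy
* `y = f_kl(x) + ∑ a, f a k l (x) ξ_a θ + g k l (x) ξ₁ ξ₂`,
* `η = ζ_kl(x) θ + ∑ a, ψ a k l (x) ξ_a + ζ' k l (x) ξ₁ ξ₂ θ`,
with the same `ξ_a`; at `ξ = 0` these are the transition maps of `S`. Being superconformal means
that the distribution spanned by `D = ∂/∂θ - θ ∂/∂x` is preserved, `D y = - η D η`; written out in
coefficients these are the relations `df_kl/dx = ζ_kl ^ 2` (part of `S`), `superconformal_f` and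
`superconformal_g`. All coefficients are functions of the point of `C`, and `f_kl` is the
coordinate `z_l`. -/
structure SuperconformalAtlas [IsManifold 𝓘(ℂ, ℂ) ω C] (S : SpinStructure C)
    (X : Supermanifold C 3) where
  κ : Type u
  V : κ → Opens C
  cover : ∀ p : C, ∃ k, p ∈ V k
  τ : κ → S.ι
  le_dom : ∀ k, V k ≤ S.dom (τ k)
  chart : ∀ k, SuperChart X.toSuperRingedSpace 3 (V k)
  f : Fin 2 → κ → κ → C → ℂ
  g : κ → κ → C → ℂ
  ψ : Fin 2 → κ → κ → C → ℂ
  ζ' : κ → κ → C → ℂ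
  hol_f : ∀ a k l, HolOn (f a k l) (V k ⊓ V l)
  hol_g : ∀ k l, HolOn (g k l) (V k ⊓ V l)
  hol_ψ : ∀ a k l, HolOn (ψ a k l) (V k ⊓ V l)
  hol_ζ' : ∀ k l, HolOn (ζ' k l) (V k ⊓ V l)
  transition_even : ∀ k l (p : (V k ⊓ V l : Opens C)),
    ((chart k).transition (chart l) (V k ⊓ V l) inf_le_left inf_le_right
      (superFun.ofHol (S.z (τ l)) ((S.holOn_z (τ l)).mono (inf_le_right.trans (le_dom l))))).1 p =
      algebraMap ℂ (Grassmann 3) (S.z (τ l) p)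
        + ∑ a : Fin 2, f a k l p • (Grassmann.gen a.succ * Grassmann.gen 0)
        + g k l p • (Grassmann.gen 1 * Grassmann.gen 2)
  transition_odd : ∀ k l (p : (V k ⊓ V l : Opens C)),
    ((chart k).transition (chart l) (V k ⊓ V l) inf_le_left inf_le_right (superFun.gen 0)).1 p =
      S.ζ (τ k) (τ l) p • Grassmann.gen 0
        + ∑ a : Fin 2, ψ a k l p • Grassmann.gen a.succ
        + ζ' k l p • (Grassmann.gen 1 * Grassmann.gen 2 * Grassmann.gen 0)
  transition_parameter : ∀ k l (a : Fin 2) (p : (V k ⊓ V l : Opens C)),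
    ((chart k).transition (chart l) (V k ⊓ V l) inf_le_left inf_le_right
      (superFun.gen a.succ)).1 p = Grassmann.gen a.succ
  superconformal_f : ∀ a k l, ∀ p ∈ V k ⊓ V l, f a k l p = S.ζ (τ k) (τ l) p * ψ a k l p
  superconformal_g : ∀ k l, ∀ p ∈ V k ⊓ V l,
    coordDeriv (S.z (τ k)) (g k l) p = 2 * S.ζ (τ k) (τ l) p * ζ' k l p
      - (coordDeriv (S.z (τ k)) (ψ 0 k l) p * ψ 1 k l p
        - ψ 0 k l p * coordDeriv (S.z (τ k)) (ψ 1 k l) p)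

variable (C) in
/-- A second-order odd deformation of the super Riemann surface `S = ΠΩ_C^{1/2}`:
a supermanifold with a superconformal atlas of order two with respect to `S`. -/
structure OddDeformation [IsManifold 𝓘(ℂ, ℂ) ω C] (S : SpinStructure C) where
  X : Supermanifold C 3
  atlas : SuperconformalAtlas S X

/-- The component over `V k` of a section of a bundle. -/
def component {κ : Type u} {V : κ → Opens C} {F : Type} [AddCommGroup F] [Module ℂ F]
    {A : κ → κ → C → F →ₗ[ℂ] F} {W : Opens C} (s : (bundleSheaf V A).obj (op W)) (k : κ) (p : C)
    (hW : p ∈ W) (hk : p ∈ V k) : F :=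
  (show bundleSections V A W from s).1 k ⟨p, mem_inf hW hk⟩

/-- The value at a point of a section of the tangent sheaf. -/
def vectorAt {W : Opens C} (v : (tangentSheaf C).obj (op W)) (p : C) (hW : p ∈ W) :
    TangentSpace 𝓘(ℂ, ℂ) p :=
  (show vectorFields C W from v).1 ⟨p, hW⟩

namespace OddDeformation

variable [IsManifold 𝓘(ℂ, ℂ) ω C] {S : SpinStructure C} (D : OddDeformation C S)

/-- `γ` is the `a`-th Kodaira–Spencer class: the class of the cocycle
`∂/∂ξ_a ↦ f a k l θ ∂/∂y + ψ a k l ∂/∂η`, which by superconformality is the cocycle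
`ψ a k l ∂/∂η` with values in `T_C^{1/2}`. -/
def IsKodairaSpencerClass (a : Fin 2) (γ : CechH1 S.halfTangentSheaf) : Prop :=
  ∃ c : Cech.Cocycle S.halfTangentSheaf D.atlas.V, CechH1.mk D.atlas.cover c = γ ∧
    ∀ k l p (hk : p ∈ D.atlas.V k) (hl : p ∈ D.atlas.V l),
      component (c.val k l) (D.atlas.τ l) p (mem_inf hk hl) (D.atlas.le_dom l hl) =
        D.atlas.ψ a k l p

/-- The Kodaira–Spencer map `T_0 ℂ^{0|2} → H¹(C, T_C^{1/2})^2` vanishes. -/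
def KodairaSpencerVanishes : Prop := ∀ a, D.IsKodairaSpencerClass a 0

/-- The transition functions of the modelling bundle `E` of the deformation, in the frames
`θ, ξ₁, ξ₂`: the linear part `η ↦ ζ_kl θ + ψ 0 k l ξ₁ + ψ 1 k l ξ₂`, `ξ_a ↦ ξ_a`. -/
def frameChange (k l : D.atlas.κ) (p : C) : (Fin 3 → ℂ) →ₗ[ℂ] (Fin 3 → ℂ) :=
  Matrix.mulVecLin !![S.ζ (D.atlas.τ k) (D.atlas.τ l) p, 0, 0;
    D.atlas.ψ 0 k l p, 1, 0;
    D.atlas.ψ 1 k l p, 0, 1]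

/-- The sheaf `⋀² E ⊗ T_C`: local components with respect to the frame
`(θ, ξ₁, ξ₂; ∂/∂z_k)` over `V k`, where `∂/∂z_l = (dz_k/dz_l) ∂/∂z_k = ζ_lk ^ 2 ∂/∂z_k`. -/
def obstructionSheaf : (Opens C)ᵒᵖ ⥤ AddCommGrpCat.{u} :=
  bundleSheaf D.atlas.V (F := ⋀[ℂ]^2 (Fin 3 → ℂ)) (fun k l p =>
    S.ζ (D.atlas.τ l) (D.atlas.τ k) p ^ 2 • exteriorPower.map 2 (D.frameChange k l p))

/-- The element `e_a ∧ e_b` of `⋀² ℂ³`, for the basis `e_0 = θ`, `e_1 = ξ₁`, `e_2 = ξ₂`. -/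
def wedge (a b : Fin 3) : ⋀[ℂ]^2 (Fin 3 → ℂ) :=
  exteriorPower.ιMulti ℂ 2 ![Pi.single a 1, Pi.single b 1]

/-- `c` is the cocycle `(∑ a, f a k l ξ_a θ + g k l ξ₁ ξ₂) ∂/∂y`, where `y = z_l`, formed by the
terms of second order in the odd coordinates of the even transition functions. Its class is the
primary obstruction class of the supermanifold. (The factor on the left is `dy/dx`.) -/
def IsPrimaryObstructionCocycle (c : Cech.Cocycle D.obstructionSheaf D.atlas.V) : Prop :=
  ∀ k l p (hk : p ∈ D.atlas.V k) (hl : p ∈ D.atlas.V l),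
    S.ζ (D.atlas.τ k) (D.atlas.τ l) p ^ 2 • component (c.val k l) k p (mem_inf hk hl) hk =
      ∑ a : Fin 2, D.atlas.f a k l p • wedge a.succ 0 + D.atlas.g k l p • wedge 1 2

/-- The atlas is the twist by the `T_C`-valued cocycle `v` of the product atlas of `S × ℂ^{0|2}`:
its transition maps are `y = f_kl + g_kl ξ₁ ξ₂`, `η = ζ_kl θ + (1/2) ζ_kl⁻¹ (dg_kl/dx) ξ₁ ξ₂ θ`,
where `v k l = g_kl ∂/∂y`. -/
def IsTwistBy (v : Cech.Cocycle (tangentSheaf C) D.atlas.V) : Prop :=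
  ∀ k l p (hk : p ∈ D.atlas.V k) (hl : p ∈ D.atlas.V l),
    (∀ a, D.atlas.f a k l p = 0 ∧ D.atlas.ψ a k l p = 0) ∧
    D.atlas.g k l p =
      chartComponent (S.z (D.atlas.τ l)) p (vectorAt (v.val k l) p (mem_inf hk hl)) ∧
    D.atlas.ζ' k l p = 1 / 2 * (S.ζ (D.atlas.τ k) (D.atlas.τ l) p)⁻¹ *
      coordDeriv (S.z (D.atlas.τ k)) (D.atlas.g k l) p

/-- `c = v ⊗ ξ₁ ξ₂`, the image of the cocycle `v` under the inclusion `T_C → ⋀² E ⊗ T_C`. -/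
def IsImageOf (c : Cech.Cocycle D.obstructionSheaf D.atlas.V)
    (v : Cech.Cocycle (tangentSheaf C) D.atlas.V) : Prop :=
  ∀ k l m p (hk : p ∈ D.atlas.V k) (hl : p ∈ D.atlas.V l) (hm : p ∈ D.atlas.V m),
    component (c.val k l) m p (mem_inf hk hl) hm =
      chartComponent (S.z (D.atlas.τ m)) p (vectorAt (v.val k l) p (mem_inf hk hl)) • wedge 1 2

end OddDeformation

end Surface

end

/-! A cocycle `g k l ∂/∂z_l` representing `γ` twists the product `S × ℂ^{0|2}`: the even coordinate
changes by `y = f + g ξ₁ ξ₂`, and with `ψ = 0` the superconformal relation forces the coefficient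
`ζ' = ½ ζ⁻¹ g'` in the odd transition. These maps satisfy the cocycle condition because
differentiating the cocycle rule of `g` gives exactly the rule required of `ζ'` (`ζ'_cocycle`,
`twist_twist`, `trans_trans`). Hence compatible families of superfunctions form the structure sheaf
of a supermanifold. Its Kodaira–Spencer map vanishes since `ψ = 0`.

Suppose this supermanifold were isomorphic to some `(C, ⋀ E)`. The split model contains the
holomorphic functions as a subsheaf of algebras; transporting them back yields a multiplicative
section `lift` of the body map. For this the isomorphism must respect bodies and the inverse of its
homeomorphism must be holomorphic. Both follow because a character of an algebra of superfunctions
can only take values of the body (`superFun.character_ne`, `body_eval`, `holAt_comp_symm`).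

Let `w k` be the coefficient of `ξ₁ ξ₂` in the lift of `z_k`, read in the chart `k`. On lifts this
coefficient is a derivation (`coeffEps_lift`), so the lift of `z_l` has the coefficient `(dz_l/dz_k)
w k` in the chart `k`. The change of charts says that the same coefficient is `w l + g k l`
(`coeffEps_twist`). Therefore `g k l = ζ² w k - w l` is a coboundary and `γ = 0`, a contradiction.

The obstruction class is treated separately: as `ψ = 0`, the coefficient of `ξ₁ ∧ ξ₂` is a
retraction of `T_C → ⋀² E ⊗ T_C`, so this inclusion is injective on cohomology. -/

noncomputable section

/-! ## The Grassmann algebra -/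

namespace Grassmann

variable {q : ℕ}

/-- The value of an element of the Grassmann algebra at zero odd coordinates. -/
def body : Grassmann q →ₐ[ℂ] ℂ := ExteriorAlgebra.algebraMapInv

/-- The left derivative with respect to an odd generator. -/
def contract (a : Fin q) : Grassmann q →ₗ[ℂ] Grassmann q :=
  CliffordAlgebra.contractLeft (LinearMap.proj a)

theorem body_algebraMap (c : ℂ) : body (algebraMap ℂ (Grassmann q) c) = c := by simp

theorem body_ι (v : Fin q → ℂ) : body (ExteriorAlgebra.ι ℂ v) = 0 := by
  simp [body, ExteriorAlgebra.algebraMapInv]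

theorem body_gen (a : Fin q) : body (gen a) = 0 := body_ι _

theorem parity_ι (v : Fin q → ℂ) :
    parity q (ExteriorAlgebra.ι ℂ v) = -ExteriorAlgebra.ι ℂ v := by
  simp [parity, ExteriorAlgebra.map_apply_ι]

theorem parity_gen (a : Fin q) : parity q (gen a) = -gen a := parity_ι _

theorem gen_mul_self (a : Fin q) : gen a * gen a = 0 := ExteriorAlgebra.ι_sq_zero _

theorem contract_ι (a : Fin q) (v : Fin q → ℂ) :
    contract a (ExteriorAlgebra.ι ℂ v) = algebraMap ℂ _ (v a) :=
  CliffordAlgebra.contractLeft_ι _ _ _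

theorem contract_gen_self (a : Fin q) : contract a (gen a) = 1 := by
  simp [gen, contract_ι]

theorem contract_gen_of_ne {a b : Fin q} (h : a ≠ b) : contract a (gen b) = 0 := by
  simp [gen, contract_ι, h]

theorem contract_algebraMap (a : Fin q) (c : ℂ) :
    contract a (algebraMap ℂ (Grassmann q) c) = 0 :=
  CliffordAlgebra.contractLeft_algebraMap _ _ _

theorem contract_one (a : Fin q) : contract a (1 : Grassmann q) = 0 :=
  CliffordAlgebra.contractLeft_one _ _

theorem contract_contract (a : Fin q) (x : Grassmann q) : contract a (contract a x) = 0 :=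
  CliffordAlgebra.contractLeft_contractLeft _ _

/-- Contraction is an odd derivation. If the rule holds for two left factors it holds for their
product, so only scalars and generators need checking; for generators it is the Clifford contraction
formula. -/
theorem contract_mul (a : Fin q) (x y : Grassmann q) :
    contract a (x * y) = contract a x * y + parity q x * contract a y := by
  induction x using ExteriorAlgebra.induction generalizing y with
  | algebraMap r => simp [Algebra.algebraMap_eq_smul_one, contract_one]
  | ι v =>
    rw [contract_ι, parity_ι]
    refine (CliffordAlgebra.contractLeft_ι_mul _ _ _).trans ?_
    simp [contract, sub_eq_add_neg, Algebra.smul_def]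
  | add x x' hx hx' => simp only [add_mul, map_add, hx, hx']; abel
  | mul x x' hx hx' => rw [mul_assoc, hx, hx', hx, map_mul]; noncomm_ring

/-- Both sides are compatible with sums and products in `x`, which reduces the claim to
anticommutation of two generators. -/
theorem gen_mul (a : Fin q) (x : Grassmann q) : gen a * x = parity q x * gen a := by
  induction x using ExteriorAlgebra.induction with
  | algebraMap r => simp [Algebra.commutes]
  | ι v =>
    rw [parity_ι, neg_mul]
    exact eq_neg_of_add_eq_zero_left (ExteriorAlgebra.ι_add_mul_swap _ _)
  | add x y hx hy => simp only [mul_add, map_add, hx, hy, add_mul]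
  | mul x y hx hy => rw [← mul_assoc, hx, mul_assoc, hy, map_mul, mul_assoc]

theorem mul_gen (a : Fin q) (x : Grassmann q) : x * gen a = gen a * parity q x := by
  rw [gen_mul, parity_parity]

theorem contract_parity (a : Fin q) (x : Grassmann q) :
    contract a (parity q x) = -parity q (contract a x) := by
  induction x using ExteriorAlgebra.induction with
  | algebraMap r => simp [contract_algebraMap]
  | ι v => simp [parity_ι, contract_ι]
  | add x y hx hy => simp only [map_add, hx, hy]; abel
  | mul x y hx hy => rw [map_mul, contract_mul, contract_mul, hx, hy]; simp [add_comm]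

theorem body_parity (x : Grassmann q) : body (parity q x) = body x := by
  have : body.comp (parity q) = body := by
    ext v
    simp [parity_ι, body_ι]
  exact DFunLike.congr_fun this x

/-- Every element is its body plus a combination of the odd generators, whose coefficients can be
chosen to depend linearly on the element. -/
theorem exists_eq_body_add : ∃ φ : Fin q → Grassmann q →ₗ[ℂ] Grassmann q,
    ∀ x, x = algebraMap ℂ _ (body x) + ∑ a, gen a * φ a x := by
  let L : (Fin q → Grassmann q) →ₗ[ℂ] Grassmann q :=
    ∑ a, LinearMap.mulLeft ℂ (gen a) ∘ₗ LinearMap.proj a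
  have hL : ∀ y, L y = ∑ a, gen a * y a := fun y => by simp [L]
  let N : Grassmann q →ₗ[ℂ] Grassmann q :=
    LinearMap.id - Algebra.linearMap ℂ _ ∘ₗ body.toLinearMap
  have hN : ∀ x, N x = x - algebraMap ℂ _ (body x) := fun x => by simp [N]
  -- The range of `L` is a right ideal, and `N (x * y) = N x * y + body x • N y` handles products.
  have hmem : ∀ x, N x ∈ LinearMap.range L := by
    intro x
    induction x using ExteriorAlgebra.induction with
    | algebraMap r => rw [hN, body_algebraMap, sub_self]; exact zero_mem _
    | ι v =>
      refine ⟨fun a => algebraMap ℂ _ (v a), ?_⟩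
      rw [hL, hN, body_ι, map_zero, sub_zero]
      conv_rhs => rw [pi_eq_sum_univ' v]
      simp [gen, ← Algebra.commutes, ← Algebra.smul_def]
    | add x y hx hy => rw [map_add]; exact add_mem hx hy
    | mul x y hx hy =>
      have e : N (x * y) = N x * y + body x • N y := by
        simp only [hN, map_mul, Algebra.smul_def]
        noncomm_ring
      rw [e]
      refine add_mem ?_ (Submodule.smul_mem _ _ hy)
      obtain ⟨z, hz⟩ := hx
      refine ⟨fun a => z a * y, ?_⟩
      rw [hL, ← hz, hL, Finset.sum_mul]
      simp [mul_assoc]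
  -- Vector spaces are projective, so `N` lifts linearly through `L`. Linearity is needed later: it
  -- keeps the coefficients of a holomorphic superfunction holomorphic.
  obtain ⟨φ, hφ⟩ := Module.projective_lifting_property L.rangeRestrict
    (N.codRestrict _ hmem) L.surjective_rangeRestrict
  refine ⟨fun a => LinearMap.proj a ∘ₗ φ, fun x => ?_⟩
  have := congrArg Subtype.val (DFunLike.congr_fun hφ x)
  simp only [LinearMap.comp_apply, LinearMap.codRestrict_apply, hN, LinearMap.rangeRestrict, hL] at this
  simp [this]

/-! ### Three odd generators -/

/-- The product `ξ₁ ξ₂` of the parameters. -/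
def eps : Grassmann 3 := gen 1 * gen 2

theorem eps_comm (x : Grassmann 3) : x * eps = eps * x := by
  rw [eps, ← mul_assoc, mul_gen 1 x, mul_assoc, mul_gen 2 (parity 3 x), parity_parity, mul_assoc]

theorem eps_mul_eps_mul (x : Grassmann 3) : eps * (eps * x) = 0 := by
  rw [← mul_assoc, eps, ← mul_assoc, ← eps, ← eps_comm (gen 1), eps, ← mul_assoc, gen_mul_self]
  simp

theorem parity_eps : parity 3 eps = eps := by
  simp [eps, parity_gen]

theorem contract_eps : contract 0 eps = 0 := by
  rw [eps, contract_mul, contract_gen_of_ne (by decide), contract_gen_of_ne (by decide)]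
  simp

/-- The projection to the multiples of `θ` (along the elements not involving `θ`), that is, the
Euler derivation `θ ∂/∂θ`. -/
def thetaPart : Grassmann 3 →ₗ[ℂ] Grassmann 3 := LinearMap.mulLeft ℂ (gen 0) ∘ₗ contract 0

theorem thetaPart_apply (x : Grassmann 3) : thetaPart x = gen 0 * contract 0 x := rfl

/-- The sign of the odd derivation `∂/∂θ` cancels against the sign of moving `θ` past `x`, so `θ
∂/∂θ` is an ordinary derivation. -/
theorem thetaPart_mul (x y : Grassmann 3) :
    thetaPart (x * y) = thetaPart x * y + x * thetaPart y := by
  simp only [thetaPart_apply, contract_mul, mul_add, ← mul_assoc]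
  rw [gen_mul 0 (parity 3 x), parity_parity]

theorem thetaPart_mul_thetaPart (x y : Grassmann 3) : thetaPart x * thetaPart y = 0 := by
  rw [thetaPart_apply, thetaPart_apply, mul_assoc, ← mul_assoc _ (gen 0), mul_gen, ← mul_assoc,
    ← mul_assoc, gen_mul_self, zero_mul, zero_mul]

theorem thetaPart_thetaPart (x : Grassmann 3) : thetaPart (thetaPart x) = thetaPart x := by
  rw [thetaPart_apply x, thetaPart_apply, contract_mul, contract_contract, contract_gen_self]
  simp

theorem thetaPart_algebraMap (c : ℂ) : thetaPart (algebraMap ℂ _ c) = 0 := by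
  rw [thetaPart_apply, contract_algebraMap, mul_zero]

theorem thetaPart_eps_mul (x : Grassmann 3) : thetaPart (eps * x) = eps * thetaPart x := by
  have : thetaPart eps = 0 := by rw [thetaPart_apply, contract_eps, mul_zero]
  rw [thetaPart_mul, this, zero_mul, zero_add]

theorem thetaPart_gen_zero : thetaPart (gen 0) = gen 0 := by
  rw [thetaPart_apply, contract_gen_self, mul_one]

theorem thetaPart_gen_succ (a : Fin 2) : thetaPart (gen a.succ) = 0 := by
  rw [thetaPart_apply, contract_gen_of_ne (Fin.succ_ne_zero a).symm, mul_zero]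

theorem thetaPart_parity (x : Grassmann 3) : thetaPart (parity 3 x) = parity 3 (thetaPart x) := by
  simp [thetaPart_apply, contract_parity, parity_gen]

theorem body_thetaPart (x : Grassmann 3) : body (thetaPart x) = 0 := by
  rw [thetaPart_apply, map_mul, body_gen, zero_mul]

/-- The coefficient of `ξ₁ ξ₂`. -/
def coeffEps : Grassmann 3 →ₗ[ℂ] ℂ := body.toLinearMap ∘ₗ contract 2 ∘ₗ contract 1

theorem coeffEps_apply (x : Grassmann 3) : coeffEps x = body (contract 2 (contract 1 x)) := rfl

/-- Two applications of the odd Leibniz rule; bodies do not see parity, and the two mixed terms come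
with opposite signs. -/
theorem coeffEps_mul (x y : Grassmann 3) : coeffEps (x * y) =
    coeffEps x * body y + body x * coeffEps y + body (contract 1 x) * body (contract 2 y)
      - body (contract 2 x) * body (contract 1 y) := by
  simp only [coeffEps_apply, contract_mul, map_add, map_mul, contract_parity, body_parity, map_neg]
  ring

theorem coeffEps_algebraMap (c : ℂ) : coeffEps (algebraMap ℂ _ c) = 0 := by
  rw [coeffEps_apply, contract_algebraMap, map_zero, map_zero]

theorem body_eps : body eps = 0 := by rw [eps, map_mul, body_gen, zero_mul]

theorem coeffEps_eps_mul (x : Grassmann 3) : coeffEps (eps * x) = body x := by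
  have h1 : contract 1 eps = gen 2 := by
    rw [eps, contract_mul, contract_gen_of_ne (by decide : (1 : Fin 3) ≠ 2), contract_gen_self]
    simp
  have h2 : contract 2 eps = -gen 1 := by
    rw [eps, contract_mul, contract_gen_of_ne (by decide : (2 : Fin 3) ≠ 1), contract_gen_self,
      parity_gen]
    simp
  rw [coeffEps_mul, coeffEps_apply, h1, h2, contract_gen_self]
  simp [body_gen, body_eps]

theorem coeffEps_thetaPart (x : Grassmann 3) : coeffEps (thetaPart x) = 0 := by
  rw [thetaPart_apply, coeffEps_mul, coeffEps_apply, contract_gen_of_ne (by decide),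
    contract_gen_of_ne (by decide)]
  simp [body_gen]

/-- For `x` without body, the first derivatives of `x * x` have no body, and the two mixed terms in
its coefficient of `ξ₁ ξ₂` cancel by antisymmetry. This disposes of the quadratic Taylor remainder
in `coeffEps_lift`; no parity of `x` is required. -/
theorem coeffEps_mul_self_mul {x : Grassmann 3} (hx : body x = 0) (y : Grassmann 3) :
    coeffEps (x * x * y) = 0 := by
  have h : ∀ a, body (contract a (x * x)) = 0 := fun a => by
    rw [contract_mul, map_add, map_mul, map_mul, body_parity, hx, mul_zero, zero_mul, add_zero]
  rw [coeffEps_mul, h, h, coeffEps_mul x x, map_mul body, hx]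
  ring

end Grassmann

/-! ## Holomorphic germs and their derivatives with respect to a coordinate -/

section Calculus

open Topology Filter

section Continuous

variable {C : Type u} [TopologicalSpace C] {F : Type*} [AddCommGroup F]

open Classical in
/-- The extension by zero of a function on an open set. -/
def extendZero {W : Opens C} (s : W → F) : C → F := fun p => if h : p ∈ W then s ⟨p, h⟩ else 0

theorem extendZero_apply {W : Opens C} (s : W → F) {p : C} (h : p ∈ W) :
    extendZero s p = s ⟨p, h⟩ := dif_pos h

theorem extendZero_coe {W : Opens C} (s : W → F) (p : W) : extendZero s p = s p :=
  extendZero_apply s p.2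

theorem isOpen_coord_image (e : OpenPartialHomeomorph C ℂ) (W : Opens C) :
    IsOpen (e.target ∩ e.symm ⁻¹' W) := e.symm.isOpen_inter_preimage W.isOpen

theorem mem_coord_image {e : OpenPartialHomeomorph C ℂ} {W : Opens C} {p : C} (hp : p ∈ e.source)
    (hW : p ∈ W) : e p ∈ e.target ∩ e.symm ⁻¹' W :=
  ⟨e.map_source hp, by simpa [e.left_inv hp] using hW⟩

variable [Module ℂ F] {G : Type*} [AddCommGroup G] [Module ℂ G]

/-- `s` has the derivative `a` with respect to the coordinate `e` at `p`. -/
def HasCoordDeriv (e : OpenPartialHomeomorph C ℂ) (s : C → F) (a : F) (p : C) : Prop :=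
  ∀ ℓ : Module.Dual ℂ F, HasDerivAt (fun x => ℓ (s (e.symm x))) (ℓ a) (e p)

/-- The derivative with respect to the coordinate `e` of a function with values in a
finite-dimensional space. -/
def vecDeriv [Module.Finite ℂ F] (e : OpenPartialHomeomorph C ℂ) (s : C → F) (p : C) : F :=
  ∑ i, coordDeriv e (fun q => (Module.finBasis ℂ F).coord i (s q)) p • Module.finBasis ℂ F i

namespace HasCoordDeriv

variable {e : OpenPartialHomeomorph C ℂ} {s t : C → F} {a b : F} {p : C}

theorem const (v : F) : HasCoordDeriv e (fun _ => v) 0 p := fun ℓ => by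
  simpa using hasDerivAt_const (e p) (ℓ v)

theorem add (hs : HasCoordDeriv e s a p) (ht : HasCoordDeriv e t b p) :
    HasCoordDeriv e (fun q => s q + t q) (a + b) p := fun ℓ => by
  simpa only [map_add] using (hs ℓ).fun_add (ht ℓ)

theorem map (hs : HasCoordDeriv e s a p) (L : F →ₗ[ℂ] G) :
    HasCoordDeriv e (fun q => L (s q)) (L a) p := fun ℓ => hs (ℓ.comp L)

theorem smul {f : C → ℂ} {f' : ℂ} (hf : HasDerivAt (f ∘ e.symm) f' (e p)) (hp : p ∈ e.source)
    (hs : HasCoordDeriv e s a p) : HasCoordDeriv e (fun q => f q • s q) (f' • s p + f p • a) p :=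
  fun ℓ => by
    have := hf.mul (hs ℓ)
    simpa [e.left_inv hp] using! this

theorem mul {A : Type*} [Ring A] [Algebra ℂ A] [Module.Finite ℂ A] {s t : C → A} {a b : A}
    (hs : HasCoordDeriv e s a p) (ht : HasCoordDeriv e t b p) (hp : p ∈ e.source) :
    HasCoordDeriv e (fun q => s q * t q) (a * t p + s p * b) p := fun ℓ => by
  let B := Module.finBasis ℂ A
  -- In a basis, a functional of a product becomes a sum of products of functionals, to which the
  -- scalar product rule applies.
  have key : ∀ x y, ℓ (x * y) = ∑ i, B.coord i x * ℓ (B i * y) := fun x y => by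
    conv_lhs => rw [← B.sum_repr x]
    simp only [Finset.sum_mul, smul_mul_assoc, map_sum, map_smul, smul_eq_mul,
      Module.Basis.coord_apply]
  rw [map_add, key, key, ← Finset.sum_add_distrib]
  simp only [key (s _)]
  refine HasDerivAt.fun_sum fun i _ => ?_
  have := (hs (B.coord i)).mul (ht (ℓ ∘ₗ LinearMap.mulLeft ℂ (B i)))
  simpa [e.left_inv hp] using! this

theorem scalar {f : C → ℂ} {f' : ℂ} (hf : HasCoordDeriv e f f' p) : coordDeriv e f p = f' :=
  (hf LinearMap.id).deriv

theorem vecDeriv_eq [Module.Finite ℂ F] (hs : HasCoordDeriv e s a p) : vecDeriv e s p = a := by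
  let B := Module.finBasis ℂ F
  rw [vecDeriv, ← B.sum_repr a]
  exact Finset.sum_congr rfl fun i _ => congrArg (· • B i) (hs (B.coord i)).deriv

end HasCoordDeriv

theorem coordDeriv_self {e : OpenPartialHomeomorph C ℂ} {p : C} (hp : p ∈ e.source) :
    coordDeriv e e p = 1 := by
  have : e ∘ e.symm =ᶠ[𝓝 (e p)] id := by
    filter_upwards [e.open_target.mem_nhds (e.map_source hp)] with x hx
    simp [e.right_inv hx]
  rw [coordDeriv, this.deriv_eq, deriv_id]

theorem coordDeriv_congr {e : OpenPartialHomeomorph C ℂ} {p : C} (hp : p ∈ e.source)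
    {f g : C → ℂ} (h : f =ᶠ[𝓝 p] g) : coordDeriv e f p = coordDeriv e g p := by
  have h1 : Tendsto e.symm (𝓝 (e p)) (𝓝 p) := e.tendsto_symm hp
  have h2 : f ∘ e.symm =ᶠ[𝓝 (e p)] g ∘ e.symm := h1.eventually h
  exact h2.deriv_eq

theorem vecDeriv_congr [Module.Finite ℂ F] {e : OpenPartialHomeomorph C ℂ} {p : C}
    (hp : p ∈ e.source) {s t : C → F} (h : s =ᶠ[𝓝 p] t) : vecDeriv e s p = vecDeriv e t p :=
  Finset.sum_congr rfl fun _ _ => congrArg (· • _) (coordDeriv_congr hp (h.fun_comp _))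

end Continuous

variable {C : Type u} [TopologicalSpace C] [ChartedSpace ℂ C]
variable {F : Type*} [AddCommGroup F] [Module ℂ F] {G : Type*} [AddCommGroup G] [Module ℂ G]

/-- A total function is holomorphic at `p` if its composition with every functional is
differentiable at `p`. -/
def HolAt (s : C → F) (p : C) : Prop :=
  ∀ ℓ : Module.Dual ℂ F, MDifferentiableAt 𝓘(ℂ, ℂ) 𝓘(ℂ, ℂ) (fun q => ℓ (s q)) p

theorem mdifferentiableAt_subtype_iff {W : Opens C} (f : C → ℂ) (p : W) :
    MDifferentiableAt 𝓘(ℂ, ℂ) 𝓘(ℂ, ℂ) (fun q : W => f q) p ↔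
      MDifferentiableAt 𝓘(ℂ, ℂ) 𝓘(ℂ, ℂ) f (p : C) :=
  (differentiableWithinAt_localInvariantProp.liftPropAt_iff_comp_subtype_val f p).symm

theorem holOn_iff {h : C → ℂ} {W : Opens C} :
    HolOn h W ↔ ∀ p ∈ W, MDifferentiableAt 𝓘(ℂ, ℂ) 𝓘(ℂ, ℂ) h p :=
  ⟨fun hh p hp => (hh p hp).mdifferentiableAt (W.isOpen.mem_nhds hp),
    fun hh p hp => (hh p hp).mdifferentiableWithinAt⟩

theorem isHol_coe_iff {W : Opens C} {f : C → F} :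
    IsHol (fun p : W => f p) ↔ ∀ p ∈ W, HolAt f p :=
  ⟨fun h p hp ℓ => (mdifferentiableAt_subtype_iff (fun q => ℓ (f q)) ⟨p, hp⟩).1 (h ℓ ⟨p, hp⟩),
    fun h ℓ p => (mdifferentiableAt_subtype_iff (fun q => ℓ (f q)) p).2 (h p p.2 ℓ)⟩

theorem isHol_iff {W : Opens C} {s : W → F} : IsHol s ↔ ∀ p ∈ W, HolAt (extendZero s) p := by
  rw [← isHol_coe_iff]
  simp only [extendZero_coe]

theorem holAt_scalar {f : C → ℂ} {p : C} :
    HolAt f p ↔ MDifferentiableAt 𝓘(ℂ, ℂ) 𝓘(ℂ, ℂ) f p := by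
  refine ⟨fun h => h LinearMap.id, fun h ℓ => ?_⟩
  have : (fun q => ℓ (f q)) = fun q => f q * ℓ 1 := by
    funext q
    rw [← smul_eq_mul, ← map_smul, smul_eq_mul, mul_one]
  rw [this]
  exact h.mul mdifferentiableAt_const

theorem holOn_iff_holAt {h : C → ℂ} {W : Opens C} : HolOn h W ↔ ∀ p ∈ W, HolAt h p := by
  simp only [holOn_iff, holAt_scalar]

namespace HolAt

variable {s t : C → F} {p : C}

theorem congr (h : HolAt s p) (hst : t =ᶠ[𝓝 p] s) : HolAt t p := fun ℓ =>
  (h ℓ).congr_of_eventuallyEq (hst.fun_comp ℓ)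

theorem const (v : F) : HolAt (fun _ : C => v) p := fun _ => mdifferentiableAt_const

theorem add (hs : HolAt s p) (ht : HolAt t p) : HolAt (fun q => s q + t q) p := fun ℓ => by
  simp only [map_add]
  exact (hs ℓ).add (ht ℓ)

theorem neg (hs : HolAt s p) : HolAt (fun q => - s q) p := fun ℓ => by
  simp only [map_neg]
  exact (hs ℓ).neg

theorem sub (hs : HolAt s p) (ht : HolAt t p) : HolAt (fun q => s q - t q) p := by
  simpa only [sub_eq_add_neg] using hs.add ht.neg

theorem map (hs : HolAt s p) (L : F →ₗ[ℂ] G) : HolAt (fun q => L (s q)) p := fun ℓ =>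
  hs (ℓ.comp L)

theorem smul {f : C → ℂ} (hf : HolAt f p) (hs : HolAt s p) : HolAt (fun q => f q • s q) p :=
  fun ℓ => by
    simp only [map_smul, smul_eq_mul]
    exact (holAt_scalar.1 hf).mul (hs ℓ)

theorem mul {f g : C → ℂ} (hf : HolAt f p) (hg : HolAt g p) : HolAt (fun q => f q * g q) p :=
  hf.smul hg

theorem sum {ι : Type*} {I : Finset ι} {s : ι → C → F} (h : ∀ i ∈ I, HolAt (s i) p) :
    HolAt (fun q => ∑ i ∈ I, s i q) p := by
  classical
  induction I using Finset.induction_on with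
  | empty => simpa using HolAt.const 0
  | insert i I hi ih =>
    simp only [Finset.sum_insert hi]
    exact (h i (by simp)).add (ih fun j hj => h j (by simp [hj]))

end HolAt

theorem mdifferentiableAt_iff_coord {e : OpenPartialHomeomorph C ℂ}
    (he : e ∈ IsManifold.maximalAtlas 𝓘(ℂ, ℂ) ω C) {p : C} (hp : p ∈ e.source) {f : C → ℂ} :
    MDifferentiableAt 𝓘(ℂ, ℂ) 𝓘(ℂ, ℂ) f p ↔ DifferentiableAt ℂ (f ∘ e.symm) (e p) := by
  rw [← mdifferentiableAt_iff_differentiableAt]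
  have h1 : MDifferentiableAt 𝓘(ℂ, ℂ) 𝓘(ℂ, ℂ) e p :=
    (contMDiffAt_of_mem_maximalAtlas he hp).mdifferentiableAt (by simp)
  have h2 : MDifferentiableAt 𝓘(ℂ, ℂ) 𝓘(ℂ, ℂ) e.symm (e p) :=
    (contMDiffAt_symm_of_mem_maximalAtlas he (e.map_source hp)).mdifferentiableAt (by simp)
  constructor
  · intro h
    refine MDifferentiableAt.comp (e p) ?_ h2
    rwa [e.left_inv hp]
  · intro h
    refine (h.comp p h1).congr_of_eventuallyEq ?_
    filter_upwards [e.open_source.mem_nhds hp] with q hq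
    simp [e.left_inv hq]

theorem hasDerivAt_coordDeriv {e : OpenPartialHomeomorph C ℂ}
    (he : e ∈ IsManifold.maximalAtlas 𝓘(ℂ, ℂ) ω C) {p : C} (hp : p ∈ e.source) {f : C → ℂ}
    (hf : HolAt f p) : HasDerivAt (f ∘ e.symm) (coordDeriv e f p) (e p) :=
  ((mdifferentiableAt_iff_coord he hp).1 (holAt_scalar.1 hf)).hasDerivAt

theorem HolAt.coord {e : OpenPartialHomeomorph C ℂ}
    (he : e ∈ IsManifold.maximalAtlas 𝓘(ℂ, ℂ) ω C) {p : C} (hp : p ∈ e.source) : HolAt e p :=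
  holAt_scalar.2 ((contMDiffAt_of_mem_maximalAtlas he hp).mdifferentiableAt (by simp))

/-- A function of the coordinate `e` that is holomorphic near `e p` is holomorphic at `p`. -/
theorem HolAt.comp_coord {e : OpenPartialHomeomorph C ℂ}
    (he : e ∈ IsManifold.maximalAtlas 𝓘(ℂ, ℂ) ω C) {p : C} (hp : p ∈ e.source) {f : ℂ → ℂ}
    (hf : DifferentiableAt ℂ f (e p)) : HolAt (fun q => f (e q)) p :=
  holAt_scalar.2 ((mdifferentiableAt_iff_differentiableAt.2 hf).comp p
    (holAt_scalar.1 (HolAt.coord he hp)))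

theorem differentiableOn_comp_symm {e : OpenPartialHomeomorph C ℂ}
    (he : e ∈ IsManifold.maximalAtlas 𝓘(ℂ, ℂ) ω C) {f : C → ℂ} {W : Opens C}
    (hf : ∀ q ∈ W, HolAt f q) :
    DifferentiableOn ℂ (f ∘ e.symm) (e.target ∩ e.symm ⁻¹' W) := by
  rintro x ⟨hx, hxW⟩
  have := (mdifferentiableAt_iff_coord he (e.map_target hx)).1 (holAt_scalar.1 (hf _ hxW))
  rw [e.right_inv hx] at this
  exact this.differentiableWithinAt

/-- A complex differentiable function on an open set has a differentiable derivative; this is why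
holomorphy is assumed on all of `W` and not only at `p`. -/
theorem HolAt.coordDeriv {e : OpenPartialHomeomorph C ℂ}
    (he : e ∈ IsManifold.maximalAtlas 𝓘(ℂ, ℂ) ω C) {f : C → ℂ} {W : Opens C}
    (hf : ∀ q ∈ W, HolAt f q) {p : C} (hp : p ∈ e.source) (hW : p ∈ W) :
    HolAt (coordDeriv e f) p :=
  HolAt.comp_coord he hp (((differentiableOn_comp_symm he hf).deriv
    (isOpen_coord_image e W)).differentiableAt
      ((isOpen_coord_image e W).mem_nhds (mem_coord_image hp hW)))

theorem hasCoordDeriv_vecDeriv [Module.Finite ℂ F] {e : OpenPartialHomeomorph C ℂ}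
    (he : e ∈ IsManifold.maximalAtlas 𝓘(ℂ, ℂ) ω C) {s : C → F} {p : C} (hp : p ∈ e.source)
    (hs : HolAt s p) : HasCoordDeriv e s (vecDeriv e s p) p := by
  intro ℓ
  let b := Module.finBasis ℂ F
  have key : (fun x => ℓ (s (e.symm x))) = fun x => ∑ i, b.coord i (s (e.symm x)) * ℓ (b i) := by
    funext x
    conv_lhs => rw [← b.sum_repr (s (e.symm x))]
    simp only [map_sum, map_smul, smul_eq_mul, Module.Basis.coord_apply]
  rw [key]
  simp only [vecDeriv, map_sum, map_smul, smul_eq_mul]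
  exact HasDerivAt.fun_sum fun i _ =>
    (hasDerivAt_coordDeriv he hp (hs.map (b.coord i))).mul_const _

theorem HolAt.vecDeriv [Module.Finite ℂ F] {e : OpenPartialHomeomorph C ℂ}
    (he : e ∈ IsManifold.maximalAtlas 𝓘(ℂ, ℂ) ω C) {s : C → F} {W : Opens C}
    (hs : ∀ q ∈ W, HolAt s q) {p : C} (hp : p ∈ e.source) (hW : p ∈ W) :
    HolAt (vecDeriv e s) p :=
  HolAt.sum fun _ _ => (HolAt.coordDeriv he (fun q hq => (hs q hq).map _) hp hW).smul
    (HolAt.const _)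

/-- The chain rule for a change of coordinates. -/
theorem HasCoordDeriv.change {e e' : OpenPartialHomeomorph C ℂ} {s : C → F} {a : F} {p : C}
    (hs : HasCoordDeriv e' s a p)
    (he : e ∈ IsManifold.maximalAtlas 𝓘(ℂ, ℂ) ω C) (he' : e' ∈ IsManifold.maximalAtlas 𝓘(ℂ, ℂ) ω C)
    (hp : p ∈ e.source) (hp' : p ∈ e'.source) :
    HasCoordDeriv e s (coordDeriv e e' p • a) p := fun ℓ => by
  have h1 : HasDerivAt (e' ∘ e.symm) (coordDeriv e e' p) (e p) :=
    hasDerivAt_coordDeriv he hp (HolAt.coord he' hp')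
  have h2 := hs ℓ
  have h3 : e' p = (e' ∘ e.symm) (e p) := by simp [e.left_inv hp]
  rw [h3] at h2
  have h4 := h2.comp (e p) h1
  rw [map_smul, smul_eq_mul, mul_comm]
  refine h4.congr_of_eventuallyEq ?_
  have h5 : Tendsto e.symm (𝓝 (e p)) (𝓝 p) := e.tendsto_symm hp
  filter_upwards [h5.eventually (e'.open_source.mem_nhds hp')] with x hx
  simp [e'.left_inv hx]

theorem coordDeriv_change {e e' : OpenPartialHomeomorph C ℂ}
    (he : e ∈ IsManifold.maximalAtlas 𝓘(ℂ, ℂ) ω C) (he' : e' ∈ IsManifold.maximalAtlas 𝓘(ℂ, ℂ) ω C)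
    {p : C} (hp : p ∈ e.source) (hp' : p ∈ e'.source) {f : C → ℂ} (hf : HolAt f p) :
    coordDeriv e f p = coordDeriv e e' p * coordDeriv e' f p := by
  have h : HasCoordDeriv e' f (coordDeriv e' f p) p := fun ℓ => by
    have h1 := (hasDerivAt_coordDeriv he' hp' hf).mul_const (ℓ 1)
    have h2 : ∀ c : ℂ, ℓ c = c * ℓ 1 := fun c => by
      rw [← smul_eq_mul, ← map_smul, smul_eq_mul, mul_one]
    rw [h2]
    refine h1.congr_of_eventuallyEq (Eventually.of_forall fun x => ?_)
    exact h2 _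
  exact (h.change he he' hp hp').scalar

/-- The first order Taylor expansion in the coordinate `e`, with holomorphic remainder. -/
theorem exists_taylor {e : OpenPartialHomeomorph C ℂ}
    (he : e ∈ IsManifold.maximalAtlas 𝓘(ℂ, ℂ) ω C) {W : Opens C} (hW : (W : Set C) ⊆ e.source)
    {f : C → ℂ} (hf : ∀ q ∈ W, HolAt f q) {p : C} (hp : p ∈ W) :
    ∃ h : C → ℂ, (∀ q ∈ W, HolAt h q) ∧ ∀ q ∈ W,
      f q = f p + coordDeriv e f p * (e q - e p) + (e q - e p) * (e q - e p) * h q := by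
  have hO := isOpen_coord_image e W
  have hn := hO.mem_nhds (mem_coord_image (hW hp) hp)
  have h1 := differentiableOn_comp_symm he hf
  -- Iterated divided differences: they stay holomorphic across `e p` by removability of the
  -- singularity, and `f₁` takes the value `f'` there.
  let f₁ := dslope (f ∘ e.symm) (e p)
  let f₂ := dslope f₁ (e p)
  have h2 : DifferentiableOn ℂ f₂ (e.target ∩ e.symm ⁻¹' W) :=
    (Complex.differentiableOn_dslope hn).2 ((Complex.differentiableOn_dslope hn).2 h1)
  refine ⟨fun q => f₂ (e q), fun q hq => HolAt.comp_coord he (hW hq)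
    (h2.differentiableAt (hO.mem_nhds (mem_coord_image (hW hq) hq))), fun q hq => ?_⟩
  have e1 : (e q - e p) * f₁ (e q) = f q - f p := by
    simpa [e.left_inv (hW hq), e.left_inv (hW hp)] using sub_smul_dslope (f ∘ e.symm) (e p) (e q)
  have e2 : (e q - e p) * f₂ (e q) = f₁ (e q) - coordDeriv e f p := by
    simpa [f₁, coordDeriv] using! sub_smul_dslope f₁ (e p) (e q)
  linear_combination -e1 - (e q - e p) * e2

/-! ### Components of vector fields -/

theorem chartComponent_change {e e' : OpenPartialHomeomorph C ℂ}
    (he : e ∈ IsManifold.maximalAtlas 𝓘(ℂ, ℂ) ω C) (he' : e' ∈ IsManifold.maximalAtlas 𝓘(ℂ, ℂ) ω C)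
    {p : C} (hp : p ∈ e.source) (hp' : p ∈ e'.source) (v : TangentSpace 𝓘(ℂ, ℂ) p) :
    chartComponent e' p v = coordDeriv e e' p * chartComponent e p v := by
  have h1 := hasDerivAt_coordDeriv he hp (HolAt.coord he' hp')
  have h2 : MDifferentiableAt 𝓘(ℂ, ℂ) 𝓘(ℂ, ℂ) e p := holAt_scalar.1 (HolAt.coord he hp)
  have h3 : e' =ᶠ[𝓝 p] (e' ∘ e.symm) ∘ e := by
    filter_upwards [e.open_source.mem_nhds hp] with q hq
    simp [e.left_inv hq]
  rw [chartComponent, h3.mfderiv_eq, mfderiv_comp p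
    (mdifferentiableAt_iff_differentiableAt.2 h1.differentiableAt) h2, mfderiv_eq_fderiv]
  change fderiv ℂ (e' ∘ e.symm) (e p) (chartComponent e p v) = _
  rw [h1.hasFDerivAt.fderiv]
  simp [mul_comm]

/-- The tangent vector `c ∂/∂e`. -/
def chartVector (e : OpenPartialHomeomorph C ℂ) (p : C) (_ : p ∈ e.source) (c : ℂ) :
    TangentSpace 𝓘(ℂ, ℂ) p :=
  (mfderiv 𝓘(ℂ, ℂ) 𝓘(ℂ, ℂ) e.symm (e p) c : TangentSpace 𝓘(ℂ, ℂ) (e.symm (e p)))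

theorem chartComponent_chartVector {e : OpenPartialHomeomorph C ℂ}
    (he : e ∈ IsManifold.maximalAtlas 𝓘(ℂ, ℂ) ω C) {p : C} (hp : p ∈ e.source) (c : ℂ) :
    chartComponent e p (chartVector e p hp c) = c := by
  have h1 : MDifferentiableAt 𝓘(ℂ, ℂ) 𝓘(ℂ, ℂ) e.symm (e p) :=
    (contMDiffAt_symm_of_mem_maximalAtlas he (e.map_source hp)).mdifferentiableAt (by simp)
  have h2 : MDifferentiableAt 𝓘(ℂ, ℂ) 𝓘(ℂ, ℂ) e (e.symm (e p)) := by
    rw [e.left_inv hp]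
    exact holAt_scalar.1 (HolAt.coord he hp)
  have h3 : e ∘ e.symm =ᶠ[𝓝 (e p)] id := by
    filter_upwards [e.open_target.mem_nhds (e.map_source hp)] with x hx
    simp [e.right_inv hx]
  have h4 := mfderiv_comp (e p) h2 h1
  rw [h3.mfderiv_eq, mfderiv_id] at h4
  have h5 := (DFunLike.congr_fun h4 c).symm
  -- The chain rule yields the derivative based at `e.symm (e p)`; freeing the base point allows it
  -- to be identified with `p`.
  have h6 : ∀ q, q = p → ∀ c' : ℂ, mfderiv 𝓘(ℂ, ℂ) 𝓘(ℂ, ℂ) e q c' =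
      (mfderiv 𝓘(ℂ, ℂ) 𝓘(ℂ, ℂ) e p c' : ℂ) := by
    rintro q rfl c'
    rfl
  rw [chartComponent, chartVector]
  exact (h6 _ (e.left_inv hp) _).symm.trans h5

/-- The vector field `w ∂/∂e` on an open set in the domain of the coordinate `e`. -/
def coordVectorField {e : OpenPartialHomeomorph C ℂ}
    (he : e ∈ IsManifold.maximalAtlas 𝓘(ℂ, ℂ) ω C) {W : Opens C} (hW : (W : Set C) ⊆ e.source)
    (w : C → ℂ) (hw : ∀ p ∈ W, HolAt w p) : (tangentSheaf C).obj (op W) :=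
  show vectorFields C W from ⟨fun p => chartVector e p (hW p.2) (w p), fun e' he' => by
    have h : ∀ p ∈ W ⊓ ⟨e'.source, e'.open_source⟩, HolAt (fun q => coordDeriv e e' q * w q) p :=
      fun p hp => (HolAt.coordDeriv (W := W ⊓ ⟨e'.source, e'.open_source⟩) he
        (fun q hq => HolAt.coord he' hq.2) (hW hp.1) hp).mul (hw p hp.1)
    convert isHol_coe_iff.2 h using 2 with p
    rw [chartComponent_change he he' (hW p.2.1) p.2.2, chartComponent_chartVector he]⟩

theorem chartComponent_coordVectorField {e : OpenPartialHomeomorph C ℂ}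
    (he : e ∈ IsManifold.maximalAtlas 𝓘(ℂ, ℂ) ω C) {W : Opens C} (hW : (W : Set C) ⊆ e.source)
    (w : C → ℂ) (hw : ∀ p ∈ W, HolAt w p) {p : C} (hp : p ∈ W) :
    chartComponent e p (vectorAt (coordVectorField he hW w hw) p hp) = w p :=
  chartComponent_chartVector he (hW hp) _

/-- Since `e.symm ∘ e` is the identity near each point, the derivative of `e` is injective, so
inside one coordinate domain the component determines the field. -/
theorem tangentSheaf_ext {e : OpenPartialHomeomorph C ℂ}
    (he : e ∈ IsManifold.maximalAtlas 𝓘(ℂ, ℂ) ω C) {W : Opens C} (hW : (W : Set C) ⊆ e.source)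
    {v w : (tangentSheaf C).obj (op W)}
    (h : ∀ p (hp : p ∈ W), chartComponent e p (vectorAt v p hp) =
      chartComponent e p (vectorAt w p hp)) : v = w := by
  have inj : ∀ p (hp : p ∈ e.source) (x : TangentSpace 𝓘(ℂ, ℂ) p), chartComponent e p x = 0 →
      x = 0 := by
    intro p hp x hx
    have h1 : MDifferentiableAt 𝓘(ℂ, ℂ) 𝓘(ℂ, ℂ) e.symm (e p) :=
      (contMDiffAt_symm_of_mem_maximalAtlas he (e.map_source hp)).mdifferentiableAt (by simp)
    have h2 : MDifferentiableAt 𝓘(ℂ, ℂ) 𝓘(ℂ, ℂ) e p := holAt_scalar.1 (HolAt.coord he hp)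
    have h3 : e.symm ∘ e =ᶠ[𝓝 p] id := by
      filter_upwards [e.open_source.mem_nhds hp] with q hq
      simp [e.left_inv hq]
    have h4 := mfderiv_comp p h1 h2
    rw [h3.mfderiv_eq, mfderiv_id] at h4
    have h5 := DFunLike.congr_fun h4 x
    change x = mfderiv 𝓘(ℂ, ℂ) 𝓘(ℂ, ℂ) e.symm (e p) (chartComponent e p x) at h5
    rw [h5, hx]
    exact map_zero _
  refine Subtype.ext (funext fun p => ?_)
  have := h p p.2
  refine sub_eq_zero.1 (inj p (hW p.2) _ ?_)
  rw [chartComponent, map_sub]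
  exact sub_eq_zero.2 this

end Calculus

/-! ## The transition operators -/

namespace Grassmann

/-- The substitution `y ↦ y + g ξ₁ ξ₂`, `θ ↦ ζ θ + ζ' ξ₁ ξ₂ θ`, applied to a superfunction with value
`x` and derivative `y`. -/
def twist (ζ ζ' g : ℂ) (x y : Grassmann 3) : Grassmann 3 :=
  x + (ζ - 1) • thetaPart x + ζ' • (eps * thetaPart x) + g • (eps * y)
    + (g * (ζ - 1)) • (eps * thetaPart y)

theorem mul_eps_mul (x y : Grassmann 3) : x * (eps * y) = eps * (x * y) := by
  rw [← mul_assoc, eps_comm, mul_assoc]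

/-- The even element `u = (ζ - 1) + ζ' eps` is central and `thetaPart` is a derivation with
`thetaPart x * thetaPart y = 0`, so `x ↦ x + u * thetaPart x` is multiplicative. -/
theorem twist_mul_aux (ζ ζ' : ℂ) (x y : Grassmann 3) :
    twist ζ ζ' 0 (x * y) 0 = twist ζ ζ' 0 x 0 * twist ζ ζ' 0 y 0 := by
  have h1 : thetaPart x * (eps * thetaPart y) = 0 := by
    rw [mul_eps_mul, thetaPart_mul_thetaPart, mul_zero]
  have h2 : eps * thetaPart x * (eps * thetaPart y) = 0 := by
    rw [mul_assoc, h1, mul_zero]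
  have h3 : eps * thetaPart x * thetaPart y = 0 := by
    rw [mul_assoc, thetaPart_mul_thetaPart, mul_zero]
  simp only [twist, mul_zero, map_zero, smul_zero, add_zero, add_mul, mul_add, smul_mul_assoc,
    mul_smul_comm, h1, h2, h3, thetaPart_mul_thetaPart, thetaPart_mul, mul_eps_mul x, mul_assoc]
  module

/-- Separates the substitution of `θ` from the shift of the even coordinate: the Taylor expansion in
`g ξ₁ ξ₂` stops at first order because `eps` squares to zero. -/
theorem twist_eq (ζ ζ' g : ℂ) (x y : Grassmann 3) :
    twist ζ ζ' g x y = twist ζ ζ' 0 x 0 + g • (eps * twist ζ ζ' 0 y 0) := by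
  simp only [twist, mul_zero, map_zero, smul_zero, add_zero, mul_add, mul_smul_comm,
    eps_mul_eps_mul]
  module

theorem twist_mul (ζ ζ' g : ℂ) (x y x' y' : Grassmann 3) :
    twist ζ ζ' g (x * x') (y * x' + x * y') = twist ζ ζ' g x y * twist ζ ζ' g x' y' := by
  have hadd : twist ζ ζ' 0 (y * x' + x * y') 0 =
      twist ζ ζ' 0 (y * x') 0 + twist ζ ζ' 0 (x * y') 0 := by
    simp only [twist, map_add, mul_add, map_zero, mul_zero, smul_add]
    module
  rw [twist_eq, twist_eq ζ ζ' g x, twist_eq ζ ζ' g x', hadd]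
  simp only [twist_mul_aux]
  generalize twist ζ ζ' 0 x 0 = a
  generalize twist ζ ζ' 0 x' 0 = a'
  generalize twist ζ ζ' 0 y 0 = b
  generalize twist ζ ζ' 0 y' 0 = b'
  simp only [add_mul, mul_add, smul_mul_assoc, mul_smul_comm, mul_eps_mul a, mul_assoc,
    mul_eps_mul b, eps_mul_eps_mul]
  module

theorem twist_add (ζ ζ' g : ℂ) (x y x' y' : Grassmann 3) :
    twist ζ ζ' g (x + x') (y + y') = twist ζ ζ' g x y + twist ζ ζ' g x' y' := by
  simp only [twist, map_add, mul_add, smul_add]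
  module

theorem twist_algebraMap (ζ ζ' g c c' : ℂ) :
    twist ζ ζ' g (algebraMap ℂ _ c) (algebraMap ℂ _ c') =
      algebraMap ℂ _ c + (g * c') • eps := by
  simp only [twist, thetaPart_algebraMap, smul_zero, mul_zero, add_zero]
  rw [Algebra.algebraMap_eq_smul_one c', mul_smul_comm, mul_one, smul_smul]

theorem twist_one_zero_zero (x y : Grassmann 3) : twist 1 0 0 x y = x := by
  simp [twist]

theorem twist_parity (ζ ζ' g : ℂ) (x y : Grassmann 3) :
    twist ζ ζ' g (parity 3 x) (parity 3 y) = parity 3 (twist ζ ζ' g x y) := by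
  simp only [twist, map_add, map_smul, map_mul, parity_eps, thetaPart_parity]

/-- The terms involving `θ` do not contribute, so the coefficient of `ξ₁ ξ₂` registers only the
shift `g`. This is how the cocycle is recovered from a splitting. -/
theorem coeffEps_twist (ζ ζ' g : ℂ) (x y : Grassmann 3) :
    coeffEps (twist ζ ζ' g x y) = coeffEps x + g * body y := by
  simp only [twist, map_add, map_smul, coeffEps_eps_mul, coeffEps_thetaPart, body_thetaPart,
    smul_eq_mul, mul_zero, add_zero]

/-- Composition of two substitutions; the second one may depend on the even coordinate, with
derivative `ζ₂d` of the coefficient of `θ`. -/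
theorem twist_twist (ζ₁ ζ₁' g₁ ζ₂ ζ₂' g₂ ζ₂d : ℂ) (x y : Grassmann 3) {d w : Grassmann 3}
    (hd : d = ζ₂ ^ 2 • y + ζ₂d • thetaPart x + ((ζ₂ - 1) * ζ₂ ^ 2) • thetaPart y + eps * w) :
    twist ζ₁ ζ₁' g₁ (twist ζ₂ ζ₂' g₂ x y) d =
    twist (ζ₁ * ζ₂) (ζ₁' * ζ₂ + ζ₁ * ζ₂' + g₁ * ζ₁ * ζ₂d) (ζ₂ ^ 2 * g₁ + g₂) x y := by
  -- The derivative `d` enters only after multiplication by `eps`, which annihilates the summand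
  -- `eps * w`.
  subst hd
  simp only [twist, map_add, map_smul, mul_add, mul_smul_comm, eps_mul_eps_mul, thetaPart_thetaPart,
    thetaPart_eps_mul, smul_zero, add_zero]
  module

end Grassmann

theorem extendZero_restrict_eventuallyEq {C : Type u} [TopologicalSpace C] {F : Type*}
    [AddCommGroup F] {W W' : Opens C} (h : W' ≤ W) (s : W → F) {p : C} (hp : p ∈ W') :
    extendZero (fun q : W' => s (Opens.inclusion h q)) =ᶠ[nhds p] extendZero s := by
  filter_upwards [W'.isOpen.mem_nhds hp] with q hq
  rw [extendZero_apply _ hq, extendZero_apply _ (h hq)]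

theorem extendZero_coe_eventuallyEq {C : Type u} [TopologicalSpace C] {F : Type*}
    [AddCommGroup F] {W : Opens C} (f : C → F) {p : C} (hp : p ∈ W) :
    extendZero (fun q : W => f q) =ᶠ[nhds p] f := by
  filter_upwards [W.isOpen.mem_nhds hp] with q hq
  rw [extendZero_apply _ hq]

/-! ### The spin and twisting cocycles in local coordinates -/

section Twist

variable {C : Type u} [TopologicalSpace C] [ChartedSpace ℂ C]

/-- A refinement of the cover of a spin structure with a `T_C`-valued cocycle on it. -/
structure TwistData (S : SpinStructure C) where
  κ : Type u
  V : κ → Opens C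
  cover : ∀ p : C, ∃ k, p ∈ V k
  τ : κ → S.ι
  le_dom : ∀ k, V k ≤ S.dom (τ k)
  v : Cech.Cocycle (tangentSheaf C) V

namespace SpinStructure

variable (S : SpinStructure C)

/-- The cocycle rule makes `ζ i i` idempotent, hence equal to its own square, and that square is
`dz_i/dz_i = 1`; the sign of the root is thereby fixed. -/
theorem ζ_self {i : S.ι} {p : C} (hp : p ∈ (S.z i).source) : S.ζ i i p = 1 := by
  have h1 := S.cocycle i i i p hp hp hp
  have h2 := S.sq i i p hp hp
  exact h1.trans ((pow_two _).symm.trans (h2.trans (coordDeriv_self hp)))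

theorem ζ_mul_ζ {i j : S.ι} {p : C} (hi : p ∈ (S.z i).source) (hj : p ∈ (S.z j).source) :
    S.ζ i j p * S.ζ j i p = 1 := by
  rw [← S.cocycle i j i p hi hj hi, S.ζ_self hi]

theorem ζ_ne_zero {i j : S.ι} {p : C} (hi : p ∈ (S.z i).source) (hj : p ∈ (S.z j).source) :
    S.ζ i j p ≠ 0 := left_ne_zero_of_mul_eq_one (S.ζ_mul_ζ hi hj)

end SpinStructure

namespace TwistData

variable {S : SpinStructure C} (T : TwistData S)

/-- The coordinate on `V k`. -/
def z (k : T.κ) : OpenPartialHomeomorph C ℂ := S.z (T.τ k)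

theorem z_mem (k : T.κ) : T.z k ∈ IsManifold.maximalAtlas 𝓘(ℂ, ℂ) ω C := S.z_mem _

theorem mem_source {k : T.κ} {p : C} (hp : p ∈ T.V k) : p ∈ (T.z k).source := T.le_dom k hp

/-- The transition functions of the spin structure, on the refined cover. -/
def ζ (k l : T.κ) : C → ℂ := S.ζ (T.τ k) (T.τ l)

open Classical in
/-- The component of the cocycle in the second coordinate. -/
def g (k l : T.κ) (p : C) : ℂ :=
  if h : p ∈ T.V k ⊓ T.V l then chartComponent (T.z l) p (vectorAt (T.v.val k l) p h) else 0

/-- The coefficient of `ξ₁ ξ₂ θ` in the transition functions. -/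
def ζ' (k l : T.κ) (p : C) : ℂ := 1 / 2 * (T.ζ k l p)⁻¹ * coordDeriv (T.z k) (T.g k l) p

section

variable {T} {k l m : T.κ} {p : C}

theorem holAt_ζ (hk : p ∈ T.V k) (hl : p ∈ T.V l) : HolAt (T.ζ k l) p :=
  holOn_iff_holAt.1 (S.hol (T.τ k) (T.τ l)) p ⟨T.mem_source hk, T.mem_source hl⟩

theorem ζ_self (hk : p ∈ T.V k) : T.ζ k k p = 1 := S.ζ_self (T.mem_source hk)

theorem ζ_ne_zero (hk : p ∈ T.V k) (hl : p ∈ T.V l) : T.ζ k l p ≠ 0 :=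
  S.ζ_ne_zero (T.mem_source hk) (T.mem_source hl)

theorem ζ_sq (hk : p ∈ T.V k) (hl : p ∈ T.V l) :
    T.ζ k l p ^ 2 = coordDeriv (T.z k) (T.z l) p :=
  S.sq _ _ p (T.mem_source hk) (T.mem_source hl)

theorem ζ_cocycle (hk : p ∈ T.V k) (hl : p ∈ T.V l) (hm : p ∈ T.V m) :
    T.ζ k m p = T.ζ k l p * T.ζ l m p :=
  S.cocycle _ _ _ p (T.mem_source hk) (T.mem_source hl) (T.mem_source hm)

theorem g_eq (hk : p ∈ T.V k) (hl : p ∈ T.V l) :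
    T.g k l p = chartComponent (T.z l) p (vectorAt (T.v.val k l) p (mem_inf hk hl)) :=
  dif_pos (mem_inf hk hl)

theorem holAt_g (hk : p ∈ T.V k) (hl : p ∈ T.V l) : HolAt (T.g k l) p := by
  have h := (show vectorFields C _ from T.v.val k l).2 (T.z l) (T.z_mem l)
  have hp : p ∈ (T.V k ⊓ T.V l) ⊓ ⟨(T.z l).source, (T.z l).open_source⟩ :=
    ⟨⟨hk, hl⟩, T.mem_source hl⟩
  refine (isHol_iff.1 h p hp).congr ?_
  filter_upwards [(Opens.isOpen _).mem_nhds hp] with q hq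
  rw [extendZero_apply _ hq, g_eq hq.1.1 hq.1.2]
  rfl

/-- The additive cocycle relation read in the coordinate `z m`; the component of `v k l` is first
carried from `z l` to `z m`, which costs the factor `dz_m/dz_l`. -/
theorem g_cocycle (hk : p ∈ T.V k) (hl : p ∈ T.V l) (hm : p ∈ T.V m) :
    T.g k m p = T.ζ l m p ^ 2 * T.g k l p + T.g l m p := by
  rw [g_eq hk hm, g_eq hk hl, g_eq hl hm, ζ_sq hl hm,
    ← chartComponent_change (T.z_mem l) (T.z_mem m) (T.mem_source hl) (T.mem_source hm)]
  have h := congrArg (fun w => chartComponent (T.z m) p (vectorAt w p (mem_inf (mem_inf hk hl) hm)))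
    (T.v.cocycle k l m)
  refine h.trans ?_
  exact map_add (mfderiv 𝓘(ℂ, ℂ) 𝓘(ℂ, ℂ) (T.z m) p) _ _

theorem g_self (hk : p ∈ T.V k) : T.g k k p = 0 := by
  have := g_cocycle hk hk hk
  rw [ζ_self hk] at this
  linear_combination -this

theorem holAt_ζ' (hk : p ∈ T.V k) (hl : p ∈ T.V l) : HolAt (T.ζ' k l) p := by
  have h1 : HolAt (fun q => (T.ζ k l q)⁻¹) p := by
    have : (fun q => (T.ζ k l q)⁻¹) =ᶠ[nhds p] T.ζ l k := by
      filter_upwards [((T.V k ⊓ T.V l).isOpen).mem_nhds (mem_inf hk hl)] with q hq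
      exact inv_eq_of_mul_eq_one_right (S.ζ_mul_ζ (T.mem_source hq.1) (T.mem_source hq.2))
    exact (holAt_ζ hl hk).congr this
  exact ((HolAt.const _).mul h1).mul (HolAt.coordDeriv (W := T.V k ⊓ T.V l) (T.z_mem k)
    (fun q hq => holAt_g hq.1 hq.2) (T.mem_source hk) (mem_inf hk hl))

theorem two_mul_ζ_mul_ζ' (hk : p ∈ T.V k) (hl : p ∈ T.V l) :
    2 * T.ζ k l p * T.ζ' k l p = coordDeriv (T.z k) (T.g k l) p := by
  rw [ζ']
  field_simp [ζ_ne_zero hk hl]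

theorem ζ'_self (hk : p ∈ T.V k) : T.ζ' k k p = 0 := by
  have h : T.g k k =ᶠ[nhds p] fun _ => 0 := by
    filter_upwards [(T.V k).isOpen.mem_nhds hk] with q hq
    exact g_self hq
  rw [ζ', coordDeriv_congr (T.mem_source hk) h]
  simp [coordDeriv, Function.comp_def]

/-- Differentiate `g_cocycle` with respect to `z k`, convert derivatives to `z l` by the factor `ζ k
l ^ 2`, and replace each derivative of `g` by `2 ζ ζ'`. The last summand comes from differentiating
`ζ l m ^ 2`. -/
theorem ζ'_cocycle (hk : p ∈ T.V k) (hl : p ∈ T.V l) (hm : p ∈ T.V m) :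
    T.ζ' k m p = T.ζ' k l p * T.ζ l m p + T.ζ k l p * T.ζ' l m p
      + T.g k l p * T.ζ k l p * coordDeriv (T.z l) (T.ζ l m) p := by
  have h : T.g k m =ᶠ[nhds p] fun q => T.ζ l m q * T.ζ l m q * T.g k l q + T.g l m q := by
    filter_upwards [((T.V k ⊓ T.V l ⊓ T.V m).isOpen).mem_nhds (mem_inf (mem_inf hk hl) hm)]
      with q hq
    rw [g_cocycle hq.1.1 hq.1.2 hq.2, sq]
  have hz := fun {f : C → ℂ} (hf : HolAt f p) =>
    coordDeriv_change (T.z_mem k) (T.z_mem l) (T.mem_source hk) (T.mem_source hl) hf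
  have d1 := hasDerivAt_coordDeriv (T.z_mem k) (T.mem_source hk) (holAt_ζ hl hm)
  have d2 := hasDerivAt_coordDeriv (T.z_mem k) (T.mem_source hk) (holAt_g hk hl)
  have d3 := hasDerivAt_coordDeriv (T.z_mem k) (T.mem_source hk) (holAt_g hl hm)
  have d4 := (((d1.mul d1).mul d2).add d3).deriv
  have d5 : coordDeriv (T.z k) (T.g k m) p = _ := (coordDeriv_congr (T.mem_source hk) h).trans d4
  simp only [Function.comp_apply, (T.z k).left_inv (T.mem_source hk), Pi.mul_apply] at d5
  rw [hz (holAt_ζ hl hm), hz (holAt_g hl hm), ← ζ_sq hk hl, ← two_mul_ζ_mul_ζ' hk hm,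
    ← two_mul_ζ_mul_ζ' hk hl, ← two_mul_ζ_mul_ζ' hl hm, ζ_cocycle hk hl hm] at d5
  have h1 := ζ_ne_zero hk hl
  have h2 := ζ_ne_zero hl hm
  -- The differentiated relation is the claim multiplied by `2 ζ k l ζ l m`.
  refine mul_left_cancel₀ (mul_ne_zero (mul_ne_zero two_ne_zero h1) h2) ?_
  linear_combination d5

end

/-! ### Transition of superfunctions -/

open Grassmann

/-- The superfunction `s` of the coordinates of the chart `l`, in the coordinates of the chart
`k`. -/
def trans (k l : T.κ) (s : C → Grassmann 3) (p : C) : Grassmann 3 :=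
  twist (T.ζ k l p) (T.ζ' k l p) (T.g k l p) (s p) (vecDeriv (T.z l) s p)

section

variable {T} {k l m : T.κ} {p : C} {s t : C → Grassmann 3}

theorem trans_congr (hl : p ∈ T.V l) (h : s =ᶠ[nhds p] t) : T.trans k l s p = T.trans k l t p := by
  rw [trans, trans, h.eq_of_nhds, vecDeriv_congr (T.mem_source hl) h]

theorem hasCoordDeriv (hl : p ∈ T.V l) (hs : HolAt s p) :
    HasCoordDeriv (T.z l) s (vecDeriv (T.z l) s p) p :=
  hasCoordDeriv_vecDeriv (T.z_mem l) (T.mem_source hl) hs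

theorem trans_mul (hl : p ∈ T.V l) (hs : HolAt s p) (ht : HolAt t p) :
    T.trans k l (fun q => s q * t q) p = T.trans k l s p * T.trans k l t p := by
  rw [trans, ((hasCoordDeriv hl hs).mul (hasCoordDeriv hl ht) (T.mem_source hl)).vecDeriv_eq]
  exact twist_mul _ _ _ _ _ _ _

theorem trans_add (hl : p ∈ T.V l) (hs : HolAt s p) (ht : HolAt t p) :
    T.trans k l (fun q => s q + t q) p = T.trans k l s p + T.trans k l t p := by
  rw [trans, ((hasCoordDeriv hl hs).add (hasCoordDeriv hl ht)).vecDeriv_eq]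
  exact twist_add _ _ _ _ _ _ _

theorem trans_algebraMap {f : C → ℂ} (hl : p ∈ T.V l) (hf : HolAt f p) :
    T.trans k l (fun q => algebraMap ℂ _ (f q)) p =
      algebraMap ℂ _ (f p) + (T.g k l p * coordDeriv (T.z l) f p) • eps := by
  have h := (hasCoordDeriv_vecDeriv (T.z_mem l) (T.mem_source hl) hf)
  have h' : vecDeriv (T.z l) (fun q => algebraMap ℂ (Grassmann 3) (f q)) p = _ :=
    (h.map (Algebra.linearMap ℂ (Grassmann 3))).vecDeriv_eq
  rw [trans, h', h.scalar]
  exact twist_algebraMap _ _ _ _ _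

theorem trans_const (a : Grassmann 3) :
    T.trans k l (fun _ => a) p = twist (T.ζ k l p) (T.ζ' k l p) (T.g k l p) a 0 := by
  rw [trans, (HasCoordDeriv.const a).vecDeriv_eq]

theorem trans_parity (hl : p ∈ T.V l) (hs : HolAt s p) :
    T.trans k l (fun q => parity 3 (s q)) p = parity 3 (T.trans k l s p) := by
  have h : vecDeriv (T.z l) (fun q => parity 3 (s q)) p = _ :=
    ((hasCoordDeriv hl hs).map (parity 3).toLinearMap).vecDeriv_eq
  rw [trans, h]
  exact twist_parity _ _ _ _ _

theorem trans_self (hk : p ∈ T.V k) : T.trans k k s p = s p := by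
  rw [trans, ζ_self hk, ζ'_self hk, g_self hk, twist_one_zero_zero]

variable {W : Opens C}

theorem holAt_trans (hs : ∀ q ∈ W, HolAt s q) (hW : p ∈ W) (hk : p ∈ T.V k) (hl : p ∈ T.V l) :
    HolAt (T.trans k l s) p := by
  have h0 := hs p hW
  have h1 := HolAt.vecDeriv (T.z_mem l) hs (T.mem_source hl) hW
  have hζ := (holAt_ζ hk hl).sub (HolAt.const 1)
  have hε : ∀ {t : C → Grassmann 3}, HolAt t p → HolAt (fun q => eps * t q) p :=
    fun ht => ht.map (LinearMap.mulLeft ℂ eps)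
  exact (((h0.add (hζ.smul (h0.map thetaPart))).add
    ((holAt_ζ' hk hl).smul (hε (h0.map thetaPart)))).add ((holAt_g hk hl).smul (hε h1))).add
      (((holAt_g hk hl).mul hζ).smul (hε (h1.map thetaPart)))

/-- The cocycle condition of the gluing. The derivative in `z l` of the inner substitution is put
into the form required by `twist_twist`, and the three cocycle rules identify the resulting
coefficients. -/
theorem trans_trans (hs : ∀ q ∈ W, HolAt s q) (hW : p ∈ W) (hk : p ∈ T.V k) (hl : p ∈ T.V l)
    (hm : p ∈ T.V m) : T.trans k l (T.trans l m s) p = T.trans k m s p := by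
  have hpl := T.mem_source hl
  -- The inner operator uses `d/dz_m`, the outer one `d/dz_l`; the chain rule supplies the factor
  -- `dz_m/dz_l = ζ l m ^ 2`.
  have d0 := (hasCoordDeriv hm (hs p hW)).change (T.z_mem l) (T.z_mem m) hpl (T.mem_source hm)
  have d1 := hasCoordDeriv hl (HolAt.vecDeriv (T.z_mem m) hs (T.mem_source hm) hW)
  have dζ := hasDerivAt_coordDeriv (T.z_mem l) hpl (holAt_ζ hl hm)
  have dζ' := hasDerivAt_coordDeriv (T.z_mem l) hpl (holAt_ζ' hl hm)
  have dg := hasDerivAt_coordDeriv (T.z_mem l) hpl (holAt_g hl hm)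
  have dζ1 : HasDerivAt ((fun q => T.ζ l m q - 1) ∘ (T.z l).symm)
    (coordDeriv (T.z l) (T.ζ l m) p) (T.z l p) := dζ.sub_const 1
  have dgζ : HasDerivAt ((fun q => T.g l m q * (T.ζ l m q - 1)) ∘ (T.z l).symm) _ (T.z l p) :=
    dg.mul dζ1
  let E := LinearMap.mulLeft ℂ (eps : Grassmann 3)
  have d := (((d0.add ((d0.map thetaPart).smul dζ1 hpl)).add
    (((d0.map thetaPart).map E).smul dζ' hpl)).add ((d1.map E).smul dg hpl)).add
      (((d1.map thetaPart).map E).smul dgζ hpl)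
  have d' : vecDeriv (T.z l) (T.trans l m s) p = _ := d.vecDeriv_eq
  rw [trans, d', trans, trans, ζ_cocycle hk hl hm, ζ'_cocycle hk hl hm, g_cocycle hk hl hm]
  -- Here `w` gathers every term of the derivative carrying a factor `eps`; its value has no
  -- influence on the result.
  refine twist_twist _ _ _ _ _ _ _ _ _ (w := coordDeriv (T.z l) (T.ζ' l m) p • thetaPart (s p)
    + (T.ζ' l m p * T.ζ l m p ^ 2) • thetaPart (vecDeriv (T.z m) s p)
    + coordDeriv (T.z l) (T.g l m) p • vecDeriv (T.z m) s p
    + T.g l m p • vecDeriv (T.z l) (vecDeriv (T.z m) s) p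
    + (coordDeriv (T.z l) (T.g l m) p * (T.ζ l m p - 1)
      + T.g l m p * coordDeriv (T.z l) (T.ζ l m) p) • thetaPart (vecDeriv (T.z m) s p)
    + (T.g l m p * (T.ζ l m p - 1)) • thetaPart (vecDeriv (T.z l) (vecDeriv (T.z m) s) p)) ?_
  simp only [E, LinearMap.mulLeft_apply, map_smul, Function.comp_apply, ζ_sq hl hm,
    (T.z l).left_inv hpl, mul_add, mul_smul_comm]
  module

end

end TwistData

end Twist

/-! ## The twisted supermanifold -/

namespace TwistData

open Grassmann

variable {C : Type u} [TopologicalSpace C] [ChartedSpace ℂ C] {S : SpinStructure C}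
  (T : TwistData S)

/-- The sections of the structure sheaf of the twisted supermanifold: families of superfunctions
related by the transition operators. -/
def sections (W : Opens C) : Subalgebra ℂ (∀ k, (W ⊓ T.V k : Opens C) → Grassmann 3) where
  carrier := {s | (∀ k, IsHol (s k)) ∧
    ∀ k l p (hW : p ∈ W) (hk : p ∈ T.V k) (_ : p ∈ T.V l),
      s k ⟨p, mem_inf hW hk⟩ = T.trans k l (extendZero (s l)) p}
  mul_mem' {s t} hs ht := ⟨fun k => (hs.1 k).mul (ht.1 k), fun k l p hW hk hl => by
    have h : extendZero ((s * t) l) = fun q => extendZero (s l) q * extendZero (t l) q := by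
      funext q
      by_cases hq : q ∈ W ⊓ T.V l <;> simp [extendZero, hq]
    rw [h, trans_mul hl (isHol_iff.1 (hs.1 l) p ⟨hW, hl⟩)
      (isHol_iff.1 (ht.1 l) p ⟨hW, hl⟩), ← hs.2 k l p hW hk hl, ← ht.2 k l p hW hk hl]
    rfl⟩
  add_mem' {s t} hs ht := ⟨fun k => (hs.1 k).add (ht.1 k), fun k l p hW hk hl => by
    have h : extendZero ((s + t) l) = fun q => extendZero (s l) q + extendZero (t l) q := by
      funext q
      by_cases hq : q ∈ W ⊓ T.V l <;> simp [extendZero, hq]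
    rw [h, trans_add hl (isHol_iff.1 (hs.1 l) p ⟨hW, hl⟩)
      (isHol_iff.1 (ht.1 l) p ⟨hW, hl⟩), ← hs.2 k l p hW hk hl, ← ht.2 k l p hW hk hl]
    rfl⟩
  algebraMap_mem' c := ⟨fun _ => IsHol.const _, fun k l p hW hk hl => by
    have h : extendZero (algebraMap ℂ (∀ k, (W ⊓ T.V k : Opens C) → Grassmann 3) c l) =ᶠ[nhds p]
        fun _ => algebraMap ℂ _ c :=
      extendZero_coe_eventuallyEq (fun _ => algebraMap ℂ _ c) (mem_inf hW hl)
    rw [trans_congr hl h, trans_algebraMap hl (HolAt.const c)]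
    simp [coordDeriv, Function.comp_def]⟩

section

variable {T} {W : Opens C} {s : ∀ k, (W ⊓ T.V k : Opens C) → Grassmann 3}

theorem restrict_mem {W' : Opens C} (h : W' ≤ W) (hs : s ∈ T.sections W) :
    (fun k p => s k (Opens.inclusion (inf_le_inf_right _ h) p)) ∈ T.sections W' :=
  ⟨fun k => (hs.1 k).restrict (inf_le_inf_right _ h), fun k l p hW hk hl =>
    (hs.2 k l p (h hW) hk hl).trans (trans_congr hl
      (extendZero_restrict_eventuallyEq (inf_le_inf_right _ h) (s l) (mem_inf hW hl)).symm)⟩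

theorem parity_mem (hs : s ∈ T.sections W) : (fun k p => parity 3 (s k p)) ∈ T.sections W := by
  refine ⟨fun k => (hs.1 k).map (parity 3).toLinearMap, fun k l p hW hk hl => ?_⟩
  have h : extendZero (fun p => parity 3 (s l p)) = fun q => parity 3 (extendZero (s l) q) := by
    funext q
    by_cases hq : q ∈ W ⊓ T.V l <;> simp [extendZero, hq]
  rw [h, trans_parity hl (isHol_iff.1 (hs.1 l) p ⟨hW, hl⟩), ← hs.2 k l p hW hk hl]

end

/-- The ringed space of the twisted supermanifold. -/
def ringedSpace : SuperRingedSpace C where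
  O :=
    { obj := fun W => AlgCat.of ℂ (T.sections W.unop)
      map := fun {W W'} i => AlgCat.ofHom
        { toFun := fun s => ⟨_, restrict_mem i.unop.le s.2⟩
          map_one' := rfl
          map_mul' := fun _ _ => rfl
          map_zero' := rfl
          map_add' := fun _ _ => rfl
          commutes' := fun _ => rfl } }
  par :=
    { app := fun W => AlgCat.ofHom
        { toFun := fun s => ⟨_, parity_mem s.2⟩
          map_one' := by ext; simp
          map_mul' := fun _ _ => by ext; simp
          map_zero' := by ext; simp
          map_add' := fun _ _ => by ext; simp
          commutes' := fun _ => by ext; simp } }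
  par_par := by
    ext W s k p
    change parity 3 (parity 3 (s.1 k p)) = s.1 k p
    exact parity_parity _

/-- The component of a section in the chart `k`. -/
def comp {W : Opens C} (s : T.ringedSpace.Sec W) (k : T.κ) : (W ⊓ T.V k : Opens C) → Grassmann 3 :=
  (show T.sections W from s).1 k

/-- Holomorphy and the gluing relations depend only on germs, so a family assembled pointwise from
compatible sections satisfies both. -/
theorem isSheaf : T.ringedSpace.O.IsSheaf := by
  rw [TopCat.Presheaf.isSheaf_iff_isSheaf_comp (forget (AlgCat.{u} ℂ))]
  refine TopCat.Presheaf.isSheaf_of_isSheafUniqueGluing_types _ fun ι U sf hsf => ?_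
  let sf' : ∀ i, T.sections (U i) := sf
  have compat : ∀ i j k p (hi : p ∈ U i) (hj : p ∈ U j) (hk : p ∈ T.V k),
      (sf' i).1 k ⟨p, mem_inf hi hk⟩ = (sf' j).1 k ⟨p, mem_inf hj hk⟩ := by
    intro i j k p hi hj hk
    have h := hsf i j
    have h' : T.ringedSpace.res (inf_le_left : U i ⊓ U j ≤ U i) (sf i) =
      T.ringedSpace.res (inf_le_right : U i ⊓ U j ≤ U j) (sf j) := h
    exact congrArg (fun s : T.sections (U i ⊓ U j) => s.1 k ⟨p, mem_inf (mem_inf hi hj) hk⟩) h'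
  have hex : ∀ p : (iSup U : Opens C), ∃ i, (p : C) ∈ U i := fun p => Opens.mem_iSup.1 p.2
  choose i hi using hex
  let s : ∀ k, (iSup U ⊓ T.V k : Opens C) → Grassmann 3 := fun k p =>
    (sf' (i ⟨p, p.2.1⟩)).1 k ⟨p, mem_inf (hi ⟨p, p.2.1⟩) p.2.2⟩
  -- The index chosen for each point may jump; compatibility shows that the germ of `s` nevertheless
  -- agrees with that of every local section.
  have hs : ∀ j k p (hj : p ∈ U j) (hk : p ∈ T.V k),
      extendZero (s k) =ᶠ[nhds p] extendZero ((sf' j).1 k) := by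
    intro j k p hj hk
    filter_upwards [(U j ⊓ T.V k).isOpen.mem_nhds (mem_inf hj hk)] with q hq
    have hq' : q ∈ iSup U := Opens.mem_iSup.2 ⟨j, hq.1⟩
    rw [extendZero_apply _ (mem_inf hq' hq.2), extendZero_apply _ (mem_inf hq.1 hq.2)]
    exact compat _ _ _ q (hi ⟨q, hq'⟩) hq.1 hq.2
  have hmem : s ∈ T.sections (iSup U) := by
    refine ⟨fun k => isHol_iff.2 fun p hp => ?_, fun k l p hW hk hl => ?_⟩
    · exact (isHol_iff.1 ((sf' (i ⟨p, hp.1⟩)).2.1 k) p ⟨hi ⟨p, hp.1⟩, hp.2⟩).congr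
        (hs _ k p (hi ⟨p, hp.1⟩) hp.2)
    · rw [trans_congr hl (hs _ l p (hi ⟨p, hW⟩) hl)]
      exact (sf' (i ⟨p, hW⟩)).2.2 k l p (hi ⟨p, hW⟩) hk hl
  refine ⟨(⟨s, hmem⟩ : T.sections (iSup U)), fun j => ?_, fun t ht => ?_⟩
  · refine Subtype.ext (funext fun k => funext fun p => ?_)
    exact compat _ j k p (hi ⟨p, Opens.mem_iSup.2 ⟨j, p.2.1⟩⟩) p.2.1 p.2.2
  · let t' : T.sections (iSup U) := t
    refine Subtype.ext (funext fun k => funext fun p => ?_)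
    let j := i ⟨p, p.2.1⟩
    have h : T.ringedSpace.res (Opens.leSupr U j).le t = sf j := ht j
    exact congrArg (fun s : T.sections (U j) => s.1 k ⟨p, mem_inf (hi ⟨p, p.2.1⟩) p.2.2⟩) h

/-- The section with the component `t` in the chart `k`. -/
theorem trans_mem {k : T.κ} {W : Opens C} (hW : W ≤ T.V k) {t : W → Grassmann 3} (ht : IsHol t) :
    (fun l (p : (W ⊓ T.V l : Opens C)) => T.trans l k (extendZero t) p) ∈ T.sections W := by
  refine ⟨fun l => isHol_coe_iff.2 fun p hp =>
    holAt_trans (isHol_iff.1 ht) hp.1 hp.2 (hW hp.1), fun l m p hp hl hm => ?_⟩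
  rw [trans_congr hm (extendZero_coe_eventuallyEq _ (mem_inf hp hm)),
    trans_trans (isHol_iff.1 ht) hp hl hm (hW hp)]

/-- The chart of the twisted supermanifold on `V k`. -/
def chart (k : T.κ) : SuperChart T.ringedSpace 3 (T.V k) where
  equiv W hW :=
    { toFun := fun s => ⟨fun p => T.comp s k ⟨p, mem_inf p.2 (hW p.2)⟩,
        (show T.sections W from s).2.1 k |>.restrict (le_inf le_rfl hW)⟩
      invFun := fun t => (⟨_, T.trans_mem hW t.2⟩ : T.sections W)
      left_inv := fun s => by
        refine Subtype.ext (funext fun l => funext fun p => ?_)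
        have h := (show T.sections W from s).2.2 l k p p.2.1 p.2.2 (hW p.2.1)
        refine Eq.trans (trans_congr (hW p.2.1) ?_) h.symm
        exact extendZero_restrict_eventuallyEq (le_inf le_rfl hW) _ p.2.1
      right_inv := fun t => by
        refine Subtype.ext (funext fun p => ?_)
        exact (trans_self (hW p.2)).trans (extendZero_coe _ _)
      map_mul' := fun _ _ => rfl
      map_add' := fun _ _ => rfl
      commutes' := fun _ => rfl }
  map_res _ _ _ _ := rfl
  map_parity _ _ _ _ := rfl

/-- The twisted supermanifold. -/
def supermanifold : Supermanifold C 3 where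
  toSuperRingedSpace := T.ringedSpace
  isSheaf := T.isSheaf
  locally_split p := by
    obtain ⟨k, hk⟩ := T.cover p
    exact ⟨T.V k, hk, ⟨T.chart k⟩⟩

theorem transition_apply (k l : T.κ) {W : Opens C} (hk : W ≤ T.V k) (hl : W ≤ T.V l)
    (t : superFun 3 W) (p : W) :
    ((T.chart k).transition (T.chart l) W hk hl t).1 p = T.trans k l (extendZero t.1) p := rfl

variable [IsManifold 𝓘(ℂ, ℂ) ω C]

/-- The superconformal atlas of the twisted supermanifold. -/
def atlas : SuperconformalAtlas S T.supermanifold where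
  κ := T.κ
  V := T.V
  cover := T.cover
  τ := T.τ
  le_dom := T.le_dom
  chart := T.chart
  f _ _ _ _ := 0
  g := T.g
  ψ _ _ _ _ := 0
  ζ' := T.ζ'
  hol_f _ _ _ := holOn_iff_holAt.2 fun _ _ => HolAt.const _
  hol_g _ _ := holOn_iff_holAt.2 fun _ hp => holAt_g hp.1 hp.2
  hol_ψ _ _ _ := holOn_iff_holAt.2 fun _ _ => HolAt.const _
  hol_ζ' _ _ := holOn_iff_holAt.2 fun _ hp => holAt_ζ' hp.1 hp.2
  transition_even k l p := by
    have hl := p.2.2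
    refine (T.transition_apply k l _ _ _ p).trans ?_
    refine (trans_congr hl
      (extendZero_coe_eventuallyEq (fun q => algebraMap ℂ _ (S.z (T.τ l) q)) p.2)).trans ?_
    rw [trans_algebraMap hl (HolAt.coord (S.z_mem _) (T.mem_source hl))]
    have h : coordDeriv (T.z l) (S.z (T.τ l)) p = 1 := coordDeriv_self (T.mem_source hl)
    rw [h]
    simp [eps]
  transition_odd k l p := by
    refine (T.transition_apply k l _ _ _ p).trans ?_
    refine (trans_congr p.2.2 (extendZero_coe_eventuallyEq (fun _ => gen 0) p.2)).trans ?_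
    rw [trans_const, twist,
      thetaPart_gen_zero, map_zero, mul_zero, smul_zero, smul_zero, ← eps]
    simp only [zero_smul, Finset.sum_const_zero, ζ]
    module
  transition_parameter k l a p := by
    refine (T.transition_apply k l _ _ _ p).trans ?_
    refine (trans_congr p.2.2 (extendZero_coe_eventuallyEq (fun _ => gen a.succ) p.2)).trans ?_
    rw [trans_const, twist, thetaPart_gen_succ]
    simp
  superconformal_f _ _ _ _ _ := by simp
  superconformal_g k l p hp := by
    have h := two_mul_ζ_mul_ζ' hp.1 hp.2
    rw [mul_zero, zero_mul, sub_zero, sub_zero]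
    exact h.symm

/-- The odd deformation given by the twisted supermanifold. -/
def deformation : OddDeformation C S := ⟨T.supermanifold, T.atlas⟩

end TwistData

/-! ## Consequences of a splitting -/

section Splitting

open Grassmann

variable {C : Type u} [TopologicalSpace C] [ChartedSpace ℂ C]

theorem HolAt.inv {f : C → ℂ} {p : C} (hf : HolAt f p) (h : f p ≠ 0) :
    HolAt (fun q => (f q)⁻¹) p :=
  holAt_scalar.2 ((mdifferentiableAt_iff_differentiableAt.2 (differentiableAt_inv h)).comp p
    (holAt_scalar.1 hf))

/-- A character of the algebra of superfunctions takes at each superfunction one of the values of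
its body. -/
theorem superFun.character_ne {q : ℕ} {W : Opens C} (χ : superFun q W →ₐ[ℂ] ℂ) {t : superFun q W}
    {c : ℂ} (h : ∀ p, body (t.1 p) ≠ c) : χ t ≠ c := by
  obtain ⟨φ, hφ⟩ := exists_eq_body_add (q := q)
  let f : C → ℂ := fun p => body (extendZero t.1 p) - c
  have hf : ∀ p ∈ W, HolAt f p := fun p hp =>
    ((isHol_iff.1 t.2 p hp).map body.toLinearMap).sub (HolAt.const c)
  have hf0 : ∀ p ∈ W, f p ≠ 0 := fun p hp => by
    simp only [f, extendZero_apply _ hp]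
    exact sub_ne_zero.2 (h ⟨p, hp⟩)
  let u : superFun q W := superFun.ofHol f (holOn_iff_holAt.2 hf)
  let u' : superFun q W := superFun.ofHol (fun p => (f p)⁻¹)
    (holOn_iff_holAt.2 fun p hp => (hf p hp).inv (hf0 p hp))
  have huu : u * u' = 1 := by
    refine Subtype.ext (funext fun p => ?_)
    change algebraMap ℂ (Grassmann q) (f p) * algebraMap ℂ (Grassmann q) (f p)⁻¹ = 1
    rw [← map_mul, mul_inv_cancel₀ (hf0 p p.2), map_one]
  have hu : χ u ≠ 0 := left_ne_zero_of_mul_eq_one (by rw [← map_mul, huu, map_one])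
  let φt : Fin q → superFun q W := fun a => ⟨fun p => φ a (t.1 p), t.2.map (φ a)⟩
  have ht : t = algebraMap ℂ _ c + u + ∑ a, superFun.gen a * φt a := by
    refine Subtype.ext (funext fun p => ?_)
    rw [Subalgebra.coe_add, Pi.add_apply, AddSubmonoidClass.coe_finsetSum, Finset.sum_apply]
    change t.1 p = algebraMap ℂ (Grassmann q) c +
      algebraMap ℂ (Grassmann q) (body (extendZero t.1 p) - c) + ∑ a, Grassmann.gen a * φ a (t.1 p)
    rw [extendZero_coe, ← map_add, add_sub_cancel]
    exact hφ _
  -- Odd generators square to zero and `χ` takes values in a field. So `χ t - c = χ u`, which is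
  -- nonzero as `u` is a unit.
  have hgen : ∀ a, χ (superFun.gen a) = 0 := fun a => by
    have h0 : (superFun.gen a : superFun q W) * superFun.gen a = 0 :=
      Subtype.ext (funext fun _ => gen_mul_self a)
    exact mul_self_eq_zero.1 (by rw [← map_mul, h0, map_zero])
  intro hc
  rw [ht, map_add, map_add, map_sum] at hc
  simp only [map_mul, hgen, zero_mul, Finset.sum_const_zero, add_zero, AlgHom.commutes] at hc
  exact hu (by simpa using hc)

/-- The functions that are holomorphic on an open set. -/
def holFun (W : Opens C) : Subalgebra ℂ (C → ℂ) where
  carrier := {f | ∀ p ∈ W, HolAt f p}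
  mul_mem' hf hg p hp := (hf p hp).mul (hg p hp)
  add_mem' hf hg p hp := (hf p hp).add (hg p hp)
  algebraMap_mem' c _ _ := HolAt.const c

/-- The restriction of holomorphic functions to a smaller open set. -/
def holFun.res {W W' : Opens C} (h : W' ≤ W) : holFun W →ₐ[ℂ] holFun W' :=
  Subalgebra.inclusion fun _ hf p hp => hf p (h hp)

/-- A ring homomorphism lifting the evaluation at `p` to the Grassmann algebra acts as a
derivation on the coefficient of `ξ₁ ξ₂`. -/
theorem coeffEps_lift {e : OpenPartialHomeomorph C ℂ}
    (he : e ∈ IsManifold.maximalAtlas 𝓘(ℂ, ℂ) ω C) {W : Opens C} (hW : (W : Set C) ⊆ e.source)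
    {p : C} (hp : p ∈ W) (χ : holFun W →ₐ[ℂ] Grassmann 3) (hχ : ∀ f, body (χ f) = f.1 p)
    (χ_congr : ∀ f f' : holFun W, (∀ q ∈ W, f.1 q = f'.1 q) → χ f = χ f') (f : holFun W) :
    coeffEps (χ f) = coordDeriv e f.1 p *
      coeffEps (χ ⟨e, fun _ hq => HolAt.coord he (hW hq)⟩) := by
  obtain ⟨h, hh, hf⟩ := exists_taylor he hW f.2 hp
  let E : holFun W := ⟨e, fun _ hq => HolAt.coord he (hW hq)⟩
  let N : holFun W := E - algebraMap ℂ _ (e p)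
  let H : holFun W := ⟨h, hh⟩
  have hN : body (χ N) = 0 := by
    rw [hχ]
    exact sub_self _
  -- Taylor expansion at `p`: `χ N` has no body, so the quadratic term contributes nothing to the
  -- coefficient of `ξ₁ ξ₂`.
  have e1 : χ f = χ (algebraMap ℂ _ (f.1 p) + coordDeriv e f.1 p • N + N * N * H) :=
    χ_congr _ _ hf
  rw [e1, map_add, map_add, map_mul χ, map_mul χ, map_add, map_add, coeffEps_mul_self_mul hN,
    map_smul, map_smul, AlgHom.commutes, coeffEps_algebraMap, map_sub, AlgHom.commutes, map_sub,
    coeffEps_algebraMap, sub_zero, add_zero, zero_add]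
  rfl

namespace HolBundle

variable {q : ℕ} (E : HolBundle C q)

/-- The value of a section of the exterior algebra in the frame over `V k`. -/
def eval {W : Opens C} {k : E.κ} {p : C} (hW : p ∈ W) (hk : p ∈ E.V k) :
    E.splitModel.Sec W →ₐ[ℂ] Grassmann q where
  toFun s := (show E.exteriorSections W from s).1 k ⟨p, mem_inf hW hk⟩
  map_one' := rfl
  map_mul' _ _ := rfl
  map_zero' := rfl
  map_add' _ _ := rfl
  commutes' _ := rfl

/-- Holomorphic functions as sections of the exterior algebra. -/
def const (W : Opens C) : holFun W →ₐ[ℂ] E.splitModel.Sec W where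
  toFun f := show E.exteriorSections W from ⟨fun _ p => algebraMap ℂ _ (f.1 p),
    fun _ => isHol_coe_iff (f := fun p => algebraMap ℂ (Grassmann q) (f.1 p)).2
      fun p hp => (f.2 p hp.1).map (Algebra.linearMap ℂ (Grassmann q)),
    fun _ _ _ _ _ _ => (AlgHom.commutes _ _).symm⟩
  map_one' := Subtype.ext (funext fun _ => funext fun _ => map_one _)
  map_mul' _ _ := Subtype.ext (funext fun _ => funext fun _ => map_mul _ _ _)
  map_zero' := Subtype.ext (funext fun _ => funext fun _ => map_zero _)
  map_add' _ _ := Subtype.ext (funext fun _ => funext fun _ => map_add _ _ _)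
  commutes' _ := rfl

end HolBundle

namespace TwistData

variable {S : SpinStructure C} (T : TwistData S)

/-- The value of a section of the twisted supermanifold in the chart `k`. -/
def eval {W : Opens C} {k : T.κ} {p : C} (hW : p ∈ W) (hk : p ∈ T.V k) :
    T.ringedSpace.Sec W →ₐ[ℂ] Grassmann 3 where
  toFun s := T.comp s k ⟨p, mem_inf hW hk⟩
  map_one' := rfl
  map_mul' _ _ := rfl
  map_zero' := rfl
  map_add' _ _ := rfl
  commutes' _ := rfl

theorem eval_res {W W' : Opens C} (h : W' ≤ W) (s : T.ringedSpace.Sec W) {k : T.κ} {p : C}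
    (hW : p ∈ W') (hk : p ∈ T.V k) : T.eval hW hk (T.ringedSpace.res h s) = T.eval (h hW) hk s := rfl

theorem extendZero_comp {W : Opens C} (s : T.ringedSpace.Sec W) {k : T.κ} {p : C}
    (hW : p ∈ W) (hk : p ∈ T.V k) : extendZero (T.comp s k) p = T.eval hW hk s :=
  extendZero_apply _ (mem_inf hW hk)

/-! ### Isomorphisms with a split model: bodies and lifted functions -/

variable {T} {E : HolBundle C 3} (Φ : T.ringedSpace.Iso E.splitModel)

/-- The preimage of an open set under the homeomorphism underlying an isomorphism. -/
abbrev pre (W : Opens C) : Opens C := Opens.comap (Φ.homeo : C(C, C)) W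

/-- The image of an open set under the homeomorphism underlying an isomorphism. -/
abbrev img (W : Opens C) : Opens C := Opens.comap (Φ.homeo.symm : C(C, C)) W

theorem pre_img_le (W : Opens C) : pre Φ (img Φ W) ≤ W := fun p hp => by
  have h : Φ.homeo.symm (Φ.homeo p) ∈ W := hp
  simpa using h

theorem mem_pre_img {W : Opens C} {p : C} (hp : p ∈ W) : p ∈ pre Φ (img Φ W) := by
  change Φ.homeo.symm (Φ.homeo p) ∈ W
  simpa using hp

/-- The body at `Φ.homeo p` on the split side is a character of the superfunctions near `p`. If its
value `c` on `s` differed from the body of `s` at `p`, continuity would keep the body away from `c`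
nearby, contradicting `superFun.character_ne`. -/
theorem body_eval {W : Opens C} (s : T.ringedSpace.Sec (pre Φ W)) {p : C} (hp : p ∈ pre Φ W)
    {k : T.κ} (hk : p ∈ T.V k) {j : E.κ} (hj : Φ.homeo p ∈ E.V j) :
    body (E.eval (show Φ.homeo p ∈ W from hp) hj (Φ.equiv W s)) = body (T.eval hp hk s) := by
  by_contra hne
  set c := body (E.eval (show Φ.homeo p ∈ W from hp) hj (Φ.equiv W s)) with hc
  let f : C → ℂ := fun q => body (extendZero (T.comp s k) q)
  have hf : HolAt f p :=
    (isHol_iff.1 ((show T.sections _ from s).2.1 k) p ⟨hp, hk⟩).map body.toLinearMap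
  have hfp : f p ≠ c := by
    simp only [f]
    rw [extendZero_apply _ (mem_inf hp hk)]
    exact Ne.symm hne
  obtain ⟨O, hO, hO', hpO⟩ := mem_nhds_iff.1
    ((holAt_scalar.1 hf).continuousAt.eventually_ne hfp)
  -- Small enough for the body of `s` to avoid `c`, for `s` to be defined and for the chart `k` to
  -- apply.
  let W' : Opens C := ⟨O, hO'⟩ ⊓ pre Φ W ⊓ T.V k
  have hW' : img Φ W' ≤ W := fun q hq => by
    have h : Φ.homeo (Φ.homeo.symm q) ∈ W := hq.1.2
    simpa using h
  have hle : pre Φ (img Φ W') ≤ T.V k := (pre_img_le Φ W').trans inf_le_right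
  have hp' : p ∈ pre Φ (img Φ W') := mem_pre_img Φ ⟨⟨hpO, hp⟩, hk⟩
  let χ : superFun 3 (pre Φ (img Φ W')) →ₐ[ℂ] ℂ :=
    (body.comp (E.eval (show Φ.homeo p ∈ img Φ W' from hp') hj)).comp
      ((Φ.equiv (img Φ W')).toAlgHom.comp ((T.chart k).equiv _ hle).symm.toAlgHom)
  let t := (T.chart k).equiv _ hle (T.ringedSpace.res (Opens.comap_mono _ hW') s)
  refine superFun.character_ne χ (t := t) (c := c) (fun q => ?_) ?_
  · have h1 := hO (pre_img_le Φ W' q.2).1.1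
    have h2 : f q = body (t.1 q) :=
      congrArg body (extendZero_apply _ (mem_inf (pre_img_le Φ W' q.2).1.2 (hle q.2)))
    rw [← h2]
    exact h1
  · change body (E.eval (show Φ.homeo p ∈ img Φ W' from hp') hj (Φ.equiv (img Φ W') (((T.chart k).equiv _ hle).symm t))) = c
    rw [AlgEquiv.symm_apply_apply, Φ.map_res hW']
    rfl

/-- Locally `f` is the body of a section; the isomorphism carries it to a holomorphic section whose
body, by `body_eval`, is `f` composed with the inverse homeomorphism. -/
theorem holAt_comp_symm {W : Opens C} {f : C → ℂ} (hf : f ∈ holFun (pre Φ W)) :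
    f ∘ Φ.homeo.symm ∈ holFun W := by
  intro y hy
  obtain ⟨k, hk⟩ := T.cover (Φ.homeo.symm y)
  obtain ⟨j, hj⟩ := E.cover y
  let W' : Opens C := W ⊓ img Φ (T.V k)
  have hle : pre Φ W' ≤ T.V k := fun q hq => pre_img_le Φ _ hq.2
  let s : T.ringedSpace.Sec (pre Φ W') := ((T.chart k).equiv _ hle).symm
    (superFun.ofHol f (holOn_iff_holAt.2 fun q hq => hf q hq.1))
  have hs := (show E.exteriorSections W' from Φ.equiv W' s).2.1 j
  have hy' : y ∈ W' ⊓ E.V j := ⟨⟨hy, hk⟩, hj⟩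
  refine ((isHol_iff.1 hs y hy').map body.toLinearMap).congr ?_
  filter_upwards [(W' ⊓ E.V j).isOpen.mem_nhds hy'] with x hx
  rw [extendZero_apply _ hx]
  obtain ⟨q, rfl⟩ := Φ.homeo.surjective x
  have hq : q ∈ pre Φ W' := hx.1
  have h1 := body_eval Φ s hq (hle hq) hx.2
  have h2 : T.eval hq (hle hq) s = algebraMap ℂ _ (f q) := by
    have := ((T.chart k).equiv _ hle).apply_symm_apply
      (superFun.ofHol f (holOn_iff_holAt.2 fun q hq => hf q hq.1))
    exact congrFun (congrArg Subtype.val this) ⟨q, hq⟩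
  rw [h2, body_algebraMap] at h1
  rw [Function.comp_apply, Homeomorph.symm_apply_apply]
  exact h1.symm

/-- The embedding of the sheaf of holomorphic functions given by a splitting. -/
def lift (W : Opens C) : holFun (pre Φ W) →ₐ[ℂ] T.ringedSpace.Sec (pre Φ W) :=
  (Φ.equiv W).symm.toAlgHom.comp ((E.const W).comp
    { toFun := fun f => ⟨_, holAt_comp_symm Φ f.2⟩
      map_one' := rfl
      map_mul' := fun _ _ => rfl
      map_zero' := rfl
      map_add' := fun _ _ => rfl
      commutes' := fun _ => rfl })

theorem equiv_lift {W : Opens C} (f : holFun (pre Φ W)) :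
    Φ.equiv W (lift Φ W f) = E.const W ⟨_, holAt_comp_symm Φ f.2⟩ :=
  (Φ.equiv W).apply_symm_apply _

theorem res_lift {W W' : Opens C} (h : W' ≤ W) (f : holFun (pre Φ W)) :
    T.ringedSpace.res (Opens.comap_mono _ h) (lift Φ W f) =
      lift Φ W' (holFun.res (Opens.comap_mono _ h) f) := by
  apply (Φ.equiv W').injective
  rw [Φ.map_res h, equiv_lift, equiv_lift]
  rfl

theorem body_eval_lift {W : Opens C} (f : holFun (pre Φ W)) {p : C} (hp : p ∈ pre Φ W)
    {k : T.κ} (hk : p ∈ T.V k) : body (T.eval hp hk (lift Φ W f)) = f.1 p := by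
  obtain ⟨j, hj⟩ := E.cover (Φ.homeo p)
  rw [← body_eval Φ _ hp hk hj, equiv_lift]
  exact (body_algebraMap _).trans (congrArg f.1 (Φ.homeo.symm_apply_apply p))

/-- Elements of `holFun` are total functions, so their arbitrary values outside the open set must be
shown not to matter. -/
theorem lift_congr {W : Opens C} {f f' : holFun (pre Φ W)} (h : ∀ q ∈ pre Φ W, f.1 q = f'.1 q) :
    lift Φ W f = lift Φ W f' := by
  apply (Φ.equiv W).injective
  rw [equiv_lift, equiv_lift]
  refine Subtype.ext (funext fun j => funext fun p => congrArg (algebraMap ℂ _) (h _ ?_))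
  change Φ.homeo (Φ.homeo.symm p) ∈ W
  simpa using p.2.1

/-- The coordinate on an open subset of the domain of a chart. -/
def coordFun {W : Opens C} (l : T.κ) (hW : W ≤ T.V l) : holFun W :=
  ⟨T.z l, fun _ hp => HolAt.coord (T.z_mem l) (T.mem_source (hW hp))⟩

/-- A splitting makes the twisting cocycle a coboundary. -/
theorem exists_primitive_of_iso (Φ : T.ringedSpace.Iso E.splitModel) :
    ∃ w : T.κ → C → ℂ, (∀ k, ∀ p ∈ T.V k, HolAt (w k) p) ∧
    ∀ k l, ∀ p ∈ T.V k, p ∈ T.V l → T.g k l p = T.ζ k l p ^ 2 * w k p - w l p := by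
  -- The lifted coordinates; their coefficients of `ξ₁ ξ₂` in their own charts will be the primitive
  -- `w`.
  let s : ∀ k, T.ringedSpace.Sec (pre Φ (img Φ (T.V k))) := fun k =>
    lift Φ _ (coordFun k (pre_img_le Φ _))
  refine ⟨fun k p => coeffEps (extendZero (T.comp (s k) k) p), fun k p hp => ?_,
    fun k l p hk hl => ?_⟩
  · exact (isHol_iff.1 ((show T.sections _ from s k).2.1 k) p ⟨mem_pre_img Φ hp, hp⟩).map coeffEps
  · let W : Opens C := img Φ (T.V k ⊓ T.V l)
    have hWp : p ∈ pre Φ W := mem_pre_img Φ ⟨hk, hl⟩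
    have hWk : pre Φ W ≤ T.V k := (pre_img_le Φ _).trans inf_le_left
    have hWl : pre Φ W ≤ T.V l := (pre_img_le Φ _).trans inf_le_right
    have w_eq : ∀ m (hm : W ≤ img Φ (T.V m)) (hpm : p ∈ T.V m),
        coeffEps (T.eval hWp hpm (lift Φ W (coordFun m
          ((Opens.comap_mono _ hm).trans (pre_img_le Φ _))))) =
        coeffEps (extendZero (T.comp (s m) m) p) := by
      intro m hm hpm
      rw [T.extendZero_comp _ (mem_pre_img Φ hpm) hpm,
        ← T.eval_res (Opens.comap_mono _ hm) (s m) hWp hpm, res_lift Φ hm]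
      rfl
    -- First computation of the coefficient of the lift of `z l` in the chart `k`: it is `dz_l/dz_k`
    -- times that of the lift of `z k`.
    have h1 := coeffEps_lift (T.z_mem k) (fun q hq => T.mem_source (hWk hq)) hWp
      ((T.eval hWp hk).comp (lift Φ W)) (fun f => body_eval_lift Φ f hWp hk)
      (fun f f' hff => congrArg (T.eval hWp hk) (lift_congr Φ hff)) (coordFun l hWl)
    -- Second computation: the value in the chart `k` is the substitution applied to the component
    -- in the chart `l`.
    have h2 : T.eval hWp hk (lift Φ W (coordFun l hWl)) =
        T.trans k l (extendZero (T.comp (lift Φ W (coordFun l hWl)) l)) p :=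
      (show T.sections _ from lift Φ W (coordFun l hWl)).2.2 k l p hWp hk hl
    have hhol : HolAt (extendZero (T.comp (lift Φ W (coordFun l hWl)) l)) p :=
      isHol_iff.1 ((show T.sections _ from lift Φ W (coordFun l hWl)).2.1 l) p ⟨hWp, hl⟩
    -- The body of the lift is `z l` itself, so its `z l`-derivative is `1` and the substitution
    -- adds exactly `g k l`.
    have h3 : body (vecDeriv (T.z l) (extendZero (T.comp (lift Φ W (coordFun l hWl)) l)) p) = 1 := by
      have d : coordDeriv (T.z l)
          (fun q => body (extendZero (T.comp (lift Φ W (coordFun l hWl)) l) q)) p = _ :=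
        ((hasCoordDeriv hl hhol).map body.toLinearMap).scalar
      refine d.symm.trans ((coordDeriv_congr (T.mem_source hl) ?_).trans
        (coordDeriv_self (T.mem_source hl)))
      filter_upwards [(pre Φ W ⊓ T.V l).isOpen.mem_nhds ⟨hWp, hl⟩] with q hq
      rw [extendZero_apply _ hq]
      exact body_eval_lift Φ _ hq.1 hq.2
    beta_reduce
    rw [← w_eq k (Opens.comap_mono _ inf_le_left) hk, ← w_eq l (Opens.comap_mono _ inf_le_right) hl,
      ζ_sq hk hl]
    refine eq_sub_of_add_eq' (Eq.trans ?_ h1)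
    refine Eq.trans ?_ (congrArg coeffEps h2).symm
    rw [trans, coeffEps_twist, h3, mul_one, extendZero_apply _ (mem_inf hWp hl)]
    rfl

end TwistData

end Splitting

/-! ## Cohomology classes -/

/-- The restriction of a cocycle to a refinement of the cover. -/
def Cech.Cocycle.refine {C : Type u} [TopologicalSpace C] {F : (Opens C)ᵒᵖ ⥤ AddCommGrpCat.{u}}
    {ι κ : Type u} {U : ι → Opens C} {V : κ → Opens C} (c : Cech.Cocycle F U) (σ : κ → ι)
    (h : ∀ k, V k ≤ U (σ k)) : Cech.Cocycle F V where
  val k l := Cech.res F (inf_le_inf (h k) (h l)) (c.val (σ k) (σ l))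
  cocycle i j k := by
    rw [Cech.res_res, Cech.res_res, Cech.res_res]
    exact c.res_eq ((inf_le_left.trans inf_le_left).trans (h i))
      ((inf_le_left.trans inf_le_right).trans (h j)) (inf_le_right.trans (h k))

theorem CechH1.mk_refine {C : Type u} [TopologicalSpace C] {F : (Opens C)ᵒᵖ ⥤ AddCommGrpCat.{u}}
    {ι κ : Type u} {U : ι → Opens C} {V : κ → Opens C} (hU : ∀ p : C, ∃ i, p ∈ U i)
    (hV : ∀ p : C, ∃ k, p ∈ V k) (c : Cech.Cocycle F U) (σ : κ → ι) (h : ∀ k, V k ≤ U (σ k)) :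
    CechH1.mk hV (c.refine σ h) = CechH1.mk hU c :=
  Quotient.sound ⟨κ, V, id, σ, fun _ => le_rfl, h, fun _ => 0, hV, fun k l => by
    change Cech.res F _ (Cech.res F _ (c.val (σ k) (σ l))) - _ = _
    rw [Cech.res_res, map_zero, map_zero, sub_self, sub_self]⟩

theorem CechH1.mk_zero {C : Type u} [TopologicalSpace C] {F : (Opens C)ᵒᵖ ⥤ AddCommGrpCat.{u}}
    {κ : Type u} {V : κ → Opens C} (hV : ∀ p : C, ∃ k, p ∈ V k) :
    CechH1.mk hV (Cech.Cocycle.zero F V) = 0 :=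
  Quotient.sound ⟨κ, V, id, fun _ => PUnit.unit, fun _ => le_rfl, fun _ => le_top, fun _ => 0, hV,
    fun _ _ => by simp [Cech.Cocycle.zero]⟩

namespace TwistData

variable {C : Type u} [TopologicalSpace C] [ChartedSpace ℂ C] {S : SpinStructure C}

/-- Intersecting the given cover with the coordinate domains of the spin structure produces a
refinement carrying the same class. -/
theorem exists_mk_eq (γ : CechH1 (tangentSheaf C)) :
    ∃ T : TwistData S, CechH1.mk T.cover T.v = γ := by
  obtain ⟨⟨ι, U, hU, c⟩, rfl⟩ := Quotient.exists_rep γ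
  have hV : ∀ p : C, ∃ x : ι × S.ι, p ∈ U x.1 ⊓ S.dom x.2 := fun p => by
    obtain ⟨i, hi⟩ := hU p
    obtain ⟨j, hj⟩ := S.cover p
    exact ⟨(i, j), hi, hj⟩
  exact ⟨⟨ι × S.ι, fun x => U x.1 ⊓ S.dom x.2, hV, Prod.snd, fun _ => inf_le_right,
    c.refine Prod.fst fun _ => inf_le_left⟩, CechH1.mk_refine hU hV c _ fun _ => inf_le_left⟩

variable (T : TwistData S)

/-- If the components of the cocycle become coboundaries on a refinement, then its class is
zero. -/
theorem mk_eq_zero {κ' : Type u} {V' : κ' → Opens C} (hV' : ∀ p : C, ∃ k, p ∈ V' k)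
    (σ : κ' → T.κ) (hσ : ∀ k, V' k ≤ T.V (σ k)) (w : κ' → C → ℂ)
    (hw : ∀ k, ∀ p ∈ V' k, HolAt (w k) p)
    (hg : ∀ k l, ∀ p ∈ V' k, p ∈ V' l →
      T.g (σ k) (σ l) p = T.ζ (σ k) (σ l) p ^ 2 * w k p - w l p) :
    CechH1.mk T.cover T.v = 0 := by
  have hs : ∀ k, (V' k : Set C) ⊆ (T.z (σ k)).source := fun k p hp => T.mem_source (hσ k hp)
  -- The coboundary convention is `β l - β k`; in the coordinate of `l` the field `w k ∂/∂z_k`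
  -- acquires the factor `ζ ^ 2`, so the sign of `w` has to be reversed.
  let β : ∀ k, (tangentSheaf C).obj (op (V' k)) := fun k =>
    coordVectorField (T.z_mem (σ k)) (hs k) (fun p => - w k p) fun p hp => (hw k p hp).neg
  have hβ : ∀ k p (hp : p ∈ V' k), chartComponent (T.z (σ k)) p (vectorAt (β k) p hp) = - w k p :=
    fun k p hp => chartComponent_coordVectorField (T.z_mem (σ k)) (hs k) _ _ hp
  refine Quotient.sound ⟨κ', V', σ, fun _ => PUnit.unit, hσ, fun _ => le_top, β, hV',
    fun k l => ?_⟩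
  refine tangentSheaf_ext (T.z_mem (σ l)) (fun p (hp : p ∈ V' k ⊓ V' l) => hs l hp.2) fun p hp => ?_
  have h1 : chartComponent (T.z (σ l)) p (vectorAt (T.v.val (σ k) (σ l)) p
      (mem_inf (hσ k hp.1) (hσ l hp.2)) - 0) = chartComponent (T.z (σ l)) p
        (vectorAt (β l) p hp.2 - vectorAt (β k) p hp.1) := by
    rw [sub_zero, ← g_eq (hσ k hp.1) (hσ l hp.2), hg k l p hp.1 hp.2, chartComponent, map_sub]
    change _ = chartComponent (T.z (σ l)) p (vectorAt (β l) p hp.2) -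
      chartComponent (T.z (σ l)) p (vectorAt (β k) p hp.1)
    rw [chartComponent_change (T.z_mem (σ k)) (T.z_mem (σ l)) (hs k hp.1) (hs l hp.2)
      (vectorAt (β k) p hp.1), hβ, hβ, ← ζ_sq (hσ k hp.1) (hσ l hp.2)]
    ring
  exact h1

variable [IsManifold 𝓘(ℂ, ℂ) ω C]

theorem kodairaSpencerVanishes : T.deformation.KodairaSpencerVanishes := fun _ =>
  ⟨Cech.Cocycle.zero _ _, CechH1.mk_zero _, fun _ _ _ _ _ => rfl⟩

theorem isTwistBy : T.deformation.IsTwistBy T.v := fun _ _ _ hk hl =>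
  ⟨fun _ => ⟨rfl, rfl⟩, g_eq hk hl, rfl⟩

theorem not_isSplit (hT : CechH1.mk T.cover T.v ≠ 0) : ¬ T.deformation.X.IsSplit := by
  rintro ⟨E, ⟨Φ⟩⟩
  obtain ⟨w, hw, hg⟩ := exists_primitive_of_iso (T := T) Φ
  exact hT (T.mk_eq_zero T.cover id (fun _ => le_rfl) w hw hg)

/-! ### The primary obstruction -/

/-- The coefficient of `ξ₁ ∧ ξ₂` in `⋀² ℂ³`. -/
def wedgeCoeff : ⋀[ℂ]^2 (Fin 3 → ℂ) →ₗ[ℂ] ℂ :=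
  exteriorPower.alternatingMapLinearEquiv
    (Matrix.detRowAlternating.compLinearMap (LinearMap.funLeft ℂ ℂ Fin.succ))

theorem wedgeCoeff_wedge : wedgeCoeff (OddDeformation.wedge 1 2) = 1 := by
  rw [wedgeCoeff, OddDeformation.wedge, exteriorPower.alternatingMapLinearEquiv_apply_ιMulti,
    AlternatingMap.compLinearMap_apply]
  refine (Matrix.det_fin_two _).trans ?_
  simp [LinearMap.funLeft]

/-- With `ψ = 0` the change of frame is `diag(ζ, 1, 1)`, so the projection along `θ` commutes with
it and the coefficient is independent of the frame. -/
theorem wedgeCoeff_map (k l : T.κ) (p : C) (x : ⋀[ℂ]^2 (Fin 3 → ℂ)) :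
    wedgeCoeff (exteriorPower.map 2 (T.deformation.frameChange k l p) x) = wedgeCoeff x := by
  have h : wedgeCoeff ∘ₗ exteriorPower.map 2 (T.deformation.frameChange k l p) = wedgeCoeff := by
    refine exteriorPower.linearMap_ext ?_
    ext v
    simp only [LinearMap.compAlternatingMap_apply, LinearMap.comp_apply,
      exteriorPower.map_apply_ιMulti, wedgeCoeff,
      exteriorPower.alternatingMapLinearEquiv_apply_ιMulti, AlternatingMap.compLinearMap_apply]
    congr 1
    funext i
    funext j
    fin_cases j <;>
    simp [OddDeformation.frameChange, deformation, atlas, LinearMap.funLeft, dotProduct, Fin.sum_univ_three]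
  exact DFunLike.congr_fun h x

theorem map_wedge (k l : T.κ) (p : C) :
    exteriorPower.map 2 (T.deformation.frameChange k l p) (OddDeformation.wedge 1 2) =
      OddDeformation.wedge 1 2 := by
  rw [OddDeformation.wedge, exteriorPower.map_apply_ιMulti]
  congr 1
  funext i
  fin_cases i <;> funext j <;> fin_cases j <;>
    simp [OddDeformation.frameChange, deformation, atlas, Matrix.mulVec, dotProduct,
      Fin.sum_univ_three]

/-- The cocycle `v ⊗ ξ₁ ξ₂`. -/
def obstructionCocycle : Cech.Cocycle T.deformation.obstructionSheaf T.V where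
  val k l := show bundleSections T.V _ (T.V k ⊓ T.V l) from
    ⟨fun m p => chartComponent (T.z m) p (vectorAt (T.v.val k l) p p.2.1) •
        OddDeformation.wedge 1 2,
      fun m => by
        have h := (show vectorFields C _ from T.v.val k l).2 (T.z m) (T.z_mem m)
        exact (h.restrict (inf_le_inf_left _ (T.le_dom m))).map
          (LinearMap.toSpanSingleton ℂ _ (OddDeformation.wedge 1 2)),
      fun m n p hW hm hn => by
        change chartComponent (T.z m) p (vectorAt (T.v.val k l) p hW) • OddDeformation.wedge 1 2 =
          T.ζ n m p ^ 2 • exteriorPower.map 2 (T.deformation.frameChange m n p)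
            (chartComponent (T.z n) p (vectorAt (T.v.val k l) p hW) • OddDeformation.wedge 1 2)
        rw [chartComponent_change (T.z_mem n) (T.z_mem m) (T.mem_source hn) (T.mem_source hm),
          ← ζ_sq hn hm, map_smul, map_wedge, mul_smul]⟩
  cocycle i j k := by
    refine Subtype.ext (funext fun m => funext fun p => ?_)
    have h := congrArg (fun w : (tangentSheaf C).obj (op (T.V i ⊓ T.V j ⊓ T.V k)) =>
      chartComponent (T.z m) p (vectorAt w p p.2.1)) (T.v.cocycle i j k)
    refine (congrArg (· • OddDeformation.wedge 1 2) (h.trans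
      (map_add (mfderiv 𝓘(ℂ, ℂ) 𝓘(ℂ, ℂ) (T.z m) p) _ _))).trans ?_
    exact add_smul _ _ _

theorem isImageOf : T.deformation.IsImageOf T.obstructionCocycle T.v :=
  fun _ _ _ _ _ _ _ => rfl

theorem isPrimaryObstructionCocycle :
    T.deformation.IsPrimaryObstructionCocycle T.obstructionCocycle := fun k l p hk hl => by
  have h := (chartComponent_change (T.z_mem k) (T.z_mem l) (T.mem_source hk) (T.mem_source hl)
    (vectorAt (T.v.val k l) p (mem_inf hk hl)))
  rw [← ζ_sq hk hl, ← g_eq hk hl] at h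
  refine (smul_smul _ _ _).trans ?_
  refine (congrArg (· • OddDeformation.wedge 1 2) h.symm).trans ?_
  simp [deformation, atlas]

/-- A cochain bounding `v ⊗ ξ₁ ξ₂` projects under `wedgeCoeff` to one bounding `v`. -/
theorem mk_obstructionCocycle_ne_zero (hT : CechH1.mk T.cover T.v ≠ 0) :
    CechH1.mk T.cover T.obstructionCocycle ≠ 0 := by
  intro h0
  obtain ⟨κ', V', σ, τ, hσ, hτ, β, hV', h⟩ := Quotient.exact h0
  let b : ∀ k, bundleSections T.V _ (V' k) := β
  refine hT (T.mk_eq_zero hV' σ hσ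
    (fun k p => - wedgeCoeff (extendZero ((b k).1 (σ k)) p)) (fun k p hp => ?_)
    (fun k l p hk hl => ?_))
  · exact ((isHol_iff.1 ((b k).2.1 (σ k)) p ⟨hp, hσ k hp⟩).map wedgeCoeff).neg
  · have hpk := hσ k hk
    have hpl := hσ l hl
    -- The coboundary equation is compared in the frame of `σ l`, in whose coordinate `g` is
    -- expressed; `h3` brings the component of `b k` into this frame.
    have h1 := congrArg (fun s => wedgeCoeff (component s (σ l) p (mem_inf hk hl) hpl)) (h k l)
    have h2 : T.g (σ k) (σ l) p = wedgeCoeff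
        (chartComponent (T.z (σ l)) p (vectorAt (T.v.val (σ k) (σ l)) p (mem_inf hpk hpl)) •
          OddDeformation.wedge 1 2 - 0) := by
      rw [sub_zero, map_smul, wedgeCoeff_wedge, smul_eq_mul, mul_one, g_eq hpk hpl]
    have h3 : wedgeCoeff ((b k).1 (σ l) ⟨p, mem_inf hk hpl⟩) =
        T.ζ (σ k) (σ l) p ^ 2 * wedgeCoeff ((b k).1 (σ k) ⟨p, mem_inf hk hpk⟩) := by
      rw [(b k).2.2 (σ l) (σ k) p hk hpl hpk, LinearMap.smul_apply, map_smul]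
      exact congrArg (T.ζ (σ k) (σ l) p ^ 2 * ·) (T.wedgeCoeff_map _ _ _ _)
    have h4 : T.g (σ k) (σ l) p = wedgeCoeff ((b l).1 (σ l) ⟨p, mem_inf hl hpl⟩ -
      (b k).1 (σ l) ⟨p, mem_inf hk hpl⟩) := h2.trans h1
    rw [h4, map_sub, h3, extendZero_apply _ (mem_inf hk hpk), extendZero_apply _ (mem_inf hl hpl)]
    ring

end TwistData

end

theorem mainTheorem4 {C : Type u} [TopologicalSpace C] [T2Space C] [ConnectedSpace C]
    [ChartedSpace ℂ C] [IsManifold 𝓘(ℂ, ℂ) ω C] (S : SpinStructure C) :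
    (Nontrivial (CechH1 (tangentSheaf C)) →
      ∃ D : OddDeformation C S, D.KodairaSpencerVanishes ∧ ¬ D.X.IsSplit) ∧
    ∀ γ : CechH1 (tangentSheaf C), γ ≠ 0 →
      ∃ D : OddDeformation C S, D.KodairaSpencerVanishes ∧ ¬ D.X.IsSplit ∧
        ∃ v : Cech.Cocycle (tangentSheaf C) D.atlas.V,
          CechH1.mk D.atlas.cover v = γ ∧ D.IsTwistBy v ∧
          ∃ c : Cech.Cocycle D.obstructionSheaf D.atlas.V,
            D.IsPrimaryObstructionCocycle c ∧ D.IsImageOf c v ∧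
            CechH1.mk D.atlas.cover c ≠ 0 := by
  constructor
  · rintro ⟨hne⟩
    obtain ⟨γ, hγ⟩ : ∃ γ : CechH1 (tangentSheaf C), γ ≠ 0 := by
      by_contra! h
      obtain ⟨a, b, hab⟩ := hne
      exact hab ((h a).trans (h b).symm)
    obtain ⟨T, rfl⟩ := TwistData.exists_mk_eq (S := S) γ
    exact ⟨T.deformation, T.kodairaSpencerVanishes, T.not_isSplit hγ⟩
  · intro γ hγ
    obtain ⟨T, rfl⟩ := TwistData.exists_mk_eq (S := S) γ
    exact ⟨T.deformation, T.kodairaSpencerVanishes, T.not_isSplit hγ, T.v, rfl, T.isTwistBy,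
      T.obstructionCocycle, T.isPrimaryObstructionCocycle, T.isImageOf,
      T.mk_obstructionCocycle_ne_zero hγ⟩
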